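/- Let $d\ge 1$, let $\Omega\subset\mathbb R^d$ be a bounded domain with smooth boundary and unit outer normal $\nu$, let $\tau>0$ and $c_0\in(1/\sqrt2,1)$, and put $Q=\Omega\times(-\tau,\tau)$, $\Sigma=\partial\Omega\times(-\tau,\tau)$. Let $H\in C^1([-\tau,\tau];\mathbb R^d)$, and let $\rho>0$ and $\theta_0\in\mathbb R^d$ with $|\theta_0|=1$ be such that $$|H'(t)|\ge\rho,\qquad \frac{H'(t)\cdot\theta_0}{|H'(t)|}\ge c_0\qquad\text{for all }t\in[-\tau,\tau].$$ Write $Au=\partial_tu+H(t)\cdot\nabla u$. Then there are points $x_0\in\mathbb R^d\setminus\overline\Omega$ with $$\frac{H'(t)\cdot(x-x_0)}{|H'(t)|\,|x-x_0|}\ge 2c_0^2-1\qquad\text{for all }(x,t)\in\overline\Omega\times[-\tau,\tau],\tag{$*$}$$ and for every $x_0\in\mathbb R^d\setminus\overline\Omega$ with $(*)$ and every $\beta$ with $0<\beta<\delta:=\rho\,(2c_0^2-1)\operatorname{dist}(x_0,\Omega)$ the following holds with $\varphi(x,t)=|x-x_0|^2-\beta t^2$. There exist constants $C,C'>0$ such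 that for all $s>0$ and all real-valued $u\in H^1(Q)$ $$\begin{aligned}s\int_{Q}e^{2s\varphi}|u|^2\,dx\,dt\le{}& C\int_{Q}e^{2s\varphi}|Au|^2\,dx\,dt+Cs\int_{\Sigma}e^{2s\varphi}\,(A\varphi)\,(H(t)\cdot\nu(x))\,|u|^2\,d\sigma\,dt\\&+C's\int_\Omega\Big(e^{2s\varphi(x,\tau)}|u(x,\tau)|^2+e^{2s\varphi(x,-\tau)}|u(x,-\tau)|^2\Big)dx.\end{aligned}$$ Here $d\sigma$ is the surface measure of $\partial\Omega$, and the values of $u$ on $\Sigma$ and on $\Omega\times\{\pm\tau\}$ are those of its trace, that is, the $L^2$ limit of the boundary values of functions that are smooth on $\overline Q$ and converge to $u$ in $H^1(Q)$. No positivity of $|H|$ is assumed. -/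

import Mathlib

open MeasureTheory Set Filter Topology
open scoped ContDiff ENNReal RealInnerProductSpace

namespace TransportCarleman

/-- `ℝ^d` with its Euclidean norm. -/
abbrev Space (d : ℕ) : Type := EuclideanSpace ℝ (Fin d)

variable {d : ℕ}

/-! ### Domains with smooth boundary -/

/-- `ψ` is a smooth function which describes `Ω` near the boundary point `p` as the set `ψ < 0`,
with `ψ p = 0` and `∇ψ p ≠ 0`. -/
def IsLocalDefiningFunction (Ω : Set (Space d)) (p : Space d) (ψ : Space d → ℝ) : Prop :=
  ContDiff ℝ ∞ ψ ∧ ψ p = 0 ∧ gradient ψ p ≠ 0 ∧ ∀ᶠ x in 𝓝 p, (x ∈ Ω ↔ ψ x < 0)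

/-- A bounded domain (nonempty, open, connected) of `ℝ^d` with smooth boundary. -/
def IsSmoothBoundedDomain (Ω : Set (Space d)) : Prop :=
  IsOpen Ω ∧ IsConnected Ω ∧ Bornology.IsBounded Ω ∧
    ∀ p ∈ frontier Ω, ∃ ψ : Space d → ℝ, IsLocalDefiningFunction Ω p ψ

open Classical in
/-- The unit outer normal `ν = ∇ψ / |∇ψ|` of `Ω` at a boundary point, where `ψ` is a local defining
function (the value does not depend on which one; it is `0` where there is none). -/
noncomputable def outerNormal (Ω : Set (Space d)) (p : Space d) : Space d :=
  if h : ∃ ψ : Space d → ℝ, IsLocalDefiningFunction Ω p ψ then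
    ‖gradient h.choose p‖⁻¹ • gradient h.choose p
  else 0

/-- The surface measure `dσ` of `∂Ω`: the `(d-1)`-dimensional Hausdorff measure, normalized so that
it is Lebesgue measure on `ℝ^(d-1)`, restricted to `∂Ω`. -/
noncomputable def surfaceMeasure (Ω : Set (Space d)) : Measure (Space d) :=
  (μHE[d - 1] : Measure (Space d)).restrict (frontier Ω)

/-! ### The space-time cylinder -/

/-- `Ω × (-τ, τ)`. -/
def cylinder (Ω : Set (Space d)) (τ : ℝ) : Set (Space d × ℝ) := Ω ×ˢ Ioo (-τ) τ

/-- The measure `dx dt` on `Ω × (-τ, τ)`. -/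
noncomputable def cylinderMeasure (Ω : Set (Space d)) (τ : ℝ) : Measure (Space d × ℝ) :=
  volume.restrict (cylinder Ω τ)

/-- The measure `dσ dt` on the lateral boundary `∂Ω × (-τ, τ)`. -/
noncomputable def lateralMeasure (Ω : Set (Space d)) (τ : ℝ) : Measure (Space d × ℝ) :=
  (surfaceMeasure Ω).prod (volume.restrict (Ioo (-τ) τ))

/-! ### Classical derivatives, the Sobolev space `H¹`, traces -/

/-- `∂_t f`. -/
noncomputable def timeDeriv (f : Space d × ℝ → ℝ) (p : Space d × ℝ) : ℝ :=
  deriv (fun r => f (p.1, r)) p.2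

/-- `∇f`, the gradient in the space variables. -/
noncomputable def spaceGrad (f : Space d × ℝ → ℝ) (p : Space d × ℝ) : Space d :=
  gradient (fun y => f (y, p.2)) p.1

/-- `u ∈ H¹(Ω × (-τ, τ))`, with weak derivatives `∂_t u = ut` and `∇u = gu`. -/
structure IsH1With (Ω : Set (Space d)) (τ : ℝ) (u ut : Space d × ℝ → ℝ)
    (gu : Space d × ℝ → Space d) : Prop where
  memLp : MemLp u 2 (cylinderMeasure Ω τ)
  memLp_time : MemLp ut 2 (cylinderMeasure Ω τ)
  memLp_space : MemLp gu 2 (cylinderMeasure Ω τ)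
  weak_time : ∀ ψ : Space d × ℝ → ℝ, ContDiff ℝ ∞ ψ → HasCompactSupport ψ →
    tsupport ψ ⊆ cylinder Ω τ →
    ∫ p, u p * timeDeriv ψ p ∂(cylinderMeasure Ω τ) = -∫ p, ut p * ψ p ∂(cylinderMeasure Ω τ)
  weak_space : ∀ ψ : Space d × ℝ → ℝ, ContDiff ℝ ∞ ψ → HasCompactSupport ψ →
    tsupport ψ ⊆ cylinder Ω τ →
    ∫ p, u p • spaceGrad ψ p ∂(cylinderMeasure Ω τ) = -∫ p, ψ p • gu p ∂(cylinderMeasure Ω τ)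

/-- `g`, read on `∂Ω × (-τ, τ)` and on `Ω × {±τ}`, is the trace on the boundary of the cylinder of
the `H¹` function `u` with weak derivatives `ut`, `gu`: it is the `L²` limit of the boundary values
of functions that are smooth up to the boundary and converge to `u` in `H¹(Ω × (-τ, τ))`. -/
structure IsTrace (Ω : Set (Space d)) (τ : ℝ) (u ut : Space d × ℝ → ℝ)
    (gu : Space d × ℝ → Space d) (g : Space d × ℝ → ℝ) : Prop where
  memLp_lateral : MemLp g 2 (lateralMeasure Ω τ)
  memLp_top : MemLp (fun x => g (x, τ)) 2 (volume.restrict Ω)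
  memLp_bot : MemLp (fun x => g (x, -τ)) 2 (volume.restrict Ω)
  exists_approx : ∃ v : ℕ → Space d × ℝ → ℝ, (∀ n, ContDiff ℝ ∞ (v n)) ∧
    Tendsto (fun n => eLpNorm (v n - u) 2 (cylinderMeasure Ω τ)) atTop (𝓝 0) ∧
    Tendsto (fun n => eLpNorm (timeDeriv (v n) - ut) 2 (cylinderMeasure Ω τ)) atTop (𝓝 0) ∧
    Tendsto (fun n => eLpNorm (spaceGrad (v n) - gu) 2 (cylinderMeasure Ω τ)) atTop (𝓝 0) ∧
    Tendsto (fun n => eLpNorm (v n - g) 2 (lateralMeasure Ω τ)) atTop (𝓝 0) ∧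
    Tendsto (fun n => eLpNorm (fun x => v n (x, τ) - g (x, τ)) 2 (volume.restrict Ω))
      atTop (𝓝 0) ∧
    Tendsto (fun n => eLpNorm (fun x => v n (x, -τ) - g (x, -τ)) 2 (volume.restrict Ω))
      atTop (𝓝 0)

/-! ### The operator and the weight -/

/-- `∂_t u + H(t) · ∇u`, in terms of the derivatives `ut = ∂_t u` and `gu = ∇u`. -/
noncomputable def transport (H : ℝ → Space d) (ut : Space d × ℝ → ℝ)
    (gu : Space d × ℝ → Space d) (p : Space d × ℝ) : ℝ :=
  ut p + ⟪H p.2, gu p⟫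

/-- The weight `φ(x, t) = |x - x₀|² - β t²`. -/
noncomputable def weight (x₀ : Space d) (β : ℝ) (p : Space d × ℝ) : ℝ :=
  ‖p.1 - x₀‖ ^ 2 - β * p.2 ^ 2

/-- `Aφ = ∂_t φ + H(t) · ∇φ` for the weight `φ`. -/
noncomputable def transportWeight (H : ℝ → Space d) (x₀ : Space d) (β : ℝ) :
    Space d × ℝ → ℝ :=
  transport H (timeDeriv (weight x₀ β)) (spaceGrad (weight x₀ β))

/-- The condition on `x₀`: it lies outside `closure Ω`, and the cosine of the angle between `H'(t)`
and `x - x₀` is at least `2 c₀² - 1` for all `x ∈ closure Ω` and `t ∈ [-τ, τ]`. -/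
def IsAdmissiblePoint (Ω : Set (Space d)) (τ c₀ : ℝ) (H : ℝ → Space d) (x₀ : Space d) : Prop :=
  x₀ ∉ closure Ω ∧ ∀ x ∈ closure Ω, ∀ t ∈ Icc (-τ) τ,
    2 * c₀ ^ 2 - 1 ≤
      ⟪derivWithin H (Icc (-τ) τ) t, x - x₀⟫ / (‖derivWithin H (Icc (-τ) τ) t‖ * ‖x - x₀‖)

end TransportCarleman

/-! The estimate is a pointwise completed square plus one integration by parts along A. Put a = Aφ
and w = e^{2sφ}v². Since Aw = e^{2sφ}(2s a v² + 2v Av), e^{2sφ}|Av|² + s A(aw) = e^{2sφ}((Av + s a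
v)² + (s a v)²) + s (Aa) w, and Aa = 2 H'·(x - x₀) - 2β + 2|H|². The term 2|H|² only helps, so |H|
may vanish; the angle condition and |H'| ≥ ρ bound the rest below by κ = 2(δ - β) > 0. Thus κ s w ≤
e^{2sφ}|Av|² + s A(aw). Integrating A(aw) leaves boundary terms: the lateral one keeps its sign,
those at ±τ are bounded by sup |Aφ|. Nothing is absorbed, so every s > 0 is allowed. This is
`carleman_of_contDiff`; `carleman_of_isTrace` passes to the limit along smooth approximations.

The integration by parts rests on the divergence theorem for the Hausdorff surface measure,
`integral_fderiv_eq_surface_integral`. No area formula is needed: near a boundary point with normal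
N the domain is a subgraph over N^⊥, and the graph map is bi-Lipschitz with constant close to 1, so
the surface measure and Lebesgue measure on N^⊥ agree up to a factor close to 1. For f ≥ 0 the
resulting error is at most ε ∫ f dσ. Such errors add up under a partition of unity to ε ∫ f dσ
again, however many pieces there are, and ε → 0.

An admissible x₀ lies far away in direction -θ₀: then x - x₀ and H' are both within arccos c₀ of θ₀,
hence within twice that angle of each other, and cos(2 arccos c₀) = 2c₀² - 1. -/

namespace TransportCarleman

/-! ### Oblique coordinates and integration over a subgraph. -/

section ObliqueCoordinates

variable {E F : Type*} [NormedAddCommGroup E] [InnerProductSpace ℝ E]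
  [NormedAddCommGroup F] [InnerProductSpace ℝ F]

/-- The open box around `p` given by the oblique coordinates `(y, t) ↦ p + y + t e`. -/
def obliqueBox (p N e : E) (h : ℝ) : Set E :=
  {x | ‖x - p - ⟪N, x - p⟫ • e‖ < h ∧ |⟪N, x - p⟫| < h}

theorem isOpen_obliqueBox (p N e : E) (h : ℝ) : IsOpen (obliqueBox p N e h) :=
  (isOpen_lt (f := fun x => ‖x - p - ⟪N, x - p⟫ • e‖) (by fun_prop) continuous_const).inter
    (isOpen_lt (f := fun x => |⟪N, x - p⟫|) (by fun_prop) continuous_const)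

theorem mem_obliqueBox_self (p N e : E) {h : ℝ} (hh : 0 < h) : p ∈ obliqueBox p N e h := by
  simp [obliqueBox, hh]

theorem inner_oblique {p N e : E} (he : ⟪N, e⟫ = 1) {ι : F →ₗᵢ[ℝ] E} (hι : ∀ y, ⟪N, ι y⟫ = 0)
    (y : F) (t : ℝ) : ⟪N, p + ι y + t • e - p⟫ = t := by
  rw [show p + ι y + t • e - p = ι y + t • e by abel, inner_add_right, hι, inner_smul_right, he]
  simp

theorem mem_obliqueBox_iff {p N e : E} {h : ℝ} (he : ⟪N, e⟫ = 1) {ι : F →ₗᵢ[ℝ] E}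
    (hι : ∀ y, ⟪N, ι y⟫ = 0) (y : F) (t : ℝ) :
    p + ι y + t • e ∈ obliqueBox p N e h ↔ ‖y‖ < h ∧ |t| < h := by
  unfold obliqueBox
  rw [mem_ofPred_eq, inner_oblique he hι, show p + ι y + t • e - p - t • e = ι y by abel,
    ι.norm_map]

/-- The isometry `(y, t) ↦ y + t N` for a unit vector `N` orthogonal to `F`. -/
noncomputable def orthogonalSum {N : E} (hN : ‖N‖ = 1) {ι : F →ₗᵢ[ℝ] E}
    (hι : ∀ y, ⟪N, ι y⟫ = 0) : WithLp 2 (F × ℝ) →ₗᵢ[ℝ] E where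
  toLinearMap := (ι.toLinearMap.coprod (LinearMap.toSpanSingleton ℝ E N)) ∘ₗ
    (WithLp.linearEquiv 2 ℝ (F × ℝ)).toLinearMap
  norm_map' q := by
    have h : ⟪ι q.fst, q.snd • N⟫ = 0 := by rw [inner_smul_right, real_inner_comm, hι, mul_zero]
    rw [← sq_eq_sq₀ (norm_nonneg _) (norm_nonneg _), WithLp.prod_norm_sq_eq_of_L2]
    change ‖ι q.fst + q.snd • N‖ ^ 2 = _
    rw [norm_add_sq_real, h, ι.norm_map, norm_smul, hN]
    ring

variable [FiniteDimensional ℝ E] [FiniteDimensional ℝ F]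

theorem exists_eq_of_inner_eq_zero {N : E} (hN : ‖N‖ = 1) {ι : F →ₗᵢ[ℝ] E}
    (hι : ∀ y, ⟪N, ι y⟫ = 0) (hd : Module.finrank ℝ E = Module.finrank ℝ F + 1) {x : E}
    (hx : ⟪N, x⟫ = 0) : ∃ y, ι y = x := by
  have hf : Module.finrank ℝ (WithLp 2 (F × ℝ)) = Module.finrank ℝ E := by
    rw [(WithLp.linearEquiv 2 ℝ (F × ℝ)).finrank_eq, Module.finrank_prod, hd, Module.finrank_self]
  obtain ⟨q, rfl⟩ := ((orthogonalSum hN hι).toLinearIsometryEquiv hf).surjective x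
  change ⟪N, ι q.fst + q.snd • N⟫ = 0 at hx
  refine ⟨q.fst, ?_⟩
  change _ = ι q.fst + q.snd • N
  rw [inner_add_right, hι, inner_smul_right, real_inner_self_eq_norm_sq, hN] at hx
  simp [show q.snd = 0 by linarith]

variable [MeasurableSpace E] [BorelSpace E] [MeasurableSpace F] [BorelSpace F]

theorem measurePreserving_shear (c : F) :
    MeasurePreserving (fun q : F × ℝ => (q.1 + q.2 • c, q.2))
      (volume.prod volume) (volume.prod volume) := by
  have h2 : MeasurePreserving (fun p : ℝ × F => (p.1, p.2 + p.1 • c))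
      (volume.prod volume) (volume.prod volume) :=
    (MeasurePreserving.id volume).skew_product (g := fun (t : ℝ) (y : F) => y + t • c)
      (by unfold Function.uncurry; fun_prop)
      (Eventually.of_forall fun t => map_add_right_eq_self volume (t • c))
  exact Measure.measurePreserving_swap.comp (h2.comp Measure.measurePreserving_swap)

/-- Oblique coordinates `(y, t) ↦ p + y + t e` on `F × ℝ` preserve volume if `⟪N, e⟫ = 1`, where
`F` is identified with `N^⊥`. -/
theorem measurePreserving_oblique (p : E) {N e : E} (hN : ‖N‖ = 1) (he : ⟪N, e⟫ = 1)
    {ι : F →ₗᵢ[ℝ] E} (hι : ∀ y, ⟪N, ι y⟫ = 0)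
    (hd : Module.finrank ℝ E = Module.finrank ℝ F + 1) :
    MeasurePreserving (fun q : F × ℝ => p + ι q.1 + q.2 • e) (volume.prod volume) volume := by
  -- As e - N is orthogonal to N, the oblique map is a shear of F × ℝ followed by the isometry (y,
  -- t) ↦ y + t N and a translation.
  obtain ⟨c, hc⟩ : ∃ c, ι c = e - N := exists_eq_of_inner_eq_zero hN hι hd (by
    rw [inner_sub_right, he, real_inner_self_eq_norm_sq, hN]
    norm_num)
  have hf : Module.finrank ℝ (WithLp 2 (F × ℝ)) = Module.finrank ℝ E := by
    rw [(WithLp.linearEquiv 2 ℝ (F × ℝ)).finrank_eq, Module.finrank_prod, hd, Module.finrank_self]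
  have h1 : MeasurePreserving (WithLp.toLp 2 : F × ℝ → WithLp 2 (F × ℝ))
      (volume.prod volume) volume := WithLp.volume_preserving_toLp F ℝ
  have h2 := ((orthogonalSum hN hι).toLinearIsometryEquiv hf).measurePreserving
  convert (measurePreserving_add_left volume p).comp
    (h2.comp (h1.comp (measurePreserving_shear c))) using 1
  ext1 q
  change _ = p + (ι (q.1 + q.2 • c) + q.2 • N)
  rw [map_add, map_smul, hc, smul_sub]
  abel

/-- Integration by parts in the direction `e` over the subgraph `t < γ y`. -/
theorem setIntegral_fderiv_subgraph {p N e : E} {h : ℝ} (hN : ‖N‖ = 1) (he : ⟪N, e⟫ = 1)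
    {ι : F →ₗᵢ[ℝ] E} (hι : ∀ y, ⟪N, ι y⟫ = 0)
    (hd : Module.finrank ℝ E = Module.finrank ℝ F + 1)
    {Ω : Set E} (hΩ : MeasurableSet Ω) {γ : F → ℝ}
    (hγ : ∀ y, ‖y‖ < h → ∀ t, |t| < h → (p + ι y + t • e ∈ Ω ↔ t < γ y))
    {f : E → ℝ} (hf : ContDiff ℝ 1 f) (hfc : HasCompactSupport f)
    (hfs : tsupport f ⊆ obliqueBox p N e h) :
    ∫ x in Ω, fderiv ℝ f x e = ∫ y in Metric.ball 0 h, f (p + ι y + γ y • e) := by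
  have hmp := measurePreserving_oblique p hN he hι hd
  have hcont : Continuous fun x => fderiv ℝ f x e :=
    (hf.continuous_fderiv one_ne_zero).clm_apply continuous_const
  have hcs : HasCompactSupport fun x => fderiv ℝ f x e := hfc.fderiv_apply (𝕜 := ℝ) e
  have hint : Integrable (Ω.indicator fun x => fderiv ℝ f x e) volume :=
    (hcont.integrable_of_hasCompactSupport hcs).indicator hΩ
  rw [← integral_indicator hΩ, ← hmp.map_eq, integral_map hmp.aemeasurable
    (by rw [hmp.map_eq]; exact hint.aestronglyMeasurable), integral_prod
    (fun q : F × ℝ => Ω.indicator (fun x => fderiv ℝ f x e)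
      (p + ι q.1 + q.2 • e)) (hmp.integrable_comp_of_integrable hint),
    ← integral_indicator measurableSet_ball]
  congr 1
  ext y
  -- The subgraph description is known only inside the box; outside it the integrand vanishes.
  have hzero : ∀ t, ¬ (‖y‖ < h ∧ |t| < h) → fderiv ℝ f (p + ι y + t • e) e = 0 := by
    intro t ht
    rw [← mem_obliqueBox_iff (p := p) he hι] at ht
    rw [fderiv_of_notMem_tsupport ℝ fun h' => ht (hfs h')]
    rfl
  by_cases hy : ‖y‖ < h
  · rw [indicator_of_mem (by simpa using hy)]
    let g : ℝ → ℝ := fun t => f (p + ι y + t • e)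
    have hg : ContDiff ℝ 1 g := hf.comp (by fun_prop)
    have hgd : ∀ t, deriv g t = fderiv ℝ f (p + ι y + t • e) e := by
      intro t
      have h1 : HasDerivAt (fun t : ℝ => p + ι y + t • e) e t := by
        simpa using ((hasDerivAt_id t).smul_const e).const_add (p + ι y : E)
      exact ((hf.differentiable one_ne_zero _).hasFDerivAt.comp_hasDerivAt t h1).deriv
    have hgc : HasCompactSupport g := by
      refine HasCompactSupport.intro (isCompact_Icc (a := -h) (b := h)) fun t ht => ?_
      refine image_eq_zero_of_notMem_tsupport (f := f) fun h' => ht ?_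
      have := ((mem_obliqueBox_iff he hι y t).1 (hfs h')).2
      exact ⟨(abs_lt.1 this).1.le, (abs_lt.1 this).2.le⟩
    change _ = g (γ y)
    rw [← hgc.integral_Iic_deriv_eq hg (γ y), ← setIntegral_congr_set Iio_ae_eq_Iic,
      ← integral_indicator measurableSet_Iio]
    congr 1
    ext t
    by_cases ht : |t| < h
    · by_cases hm : t < γ y
      · rw [indicator_of_mem ((hγ y hy t ht).2 hm), indicator_of_mem (by exact hm), hgd]
      · rw [indicator_of_notMem (mt (hγ y hy t ht).1 hm), indicator_of_notMem (by exact hm)]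
    · have h0 := hzero t (fun h' => ht h'.2)
      exact ((indicator_apply_eq_zero (f := fun x => fderiv ℝ f x e)).2 fun _ => h0).trans
        (indicator_apply_eq_zero.2 fun _ => (hgd t).trans h0).symm
  · rw [indicator_of_notMem (by simpa using hy)]
    refine integral_eq_zero_of_ae (Eventually.of_forall fun t => ?_)
    exact (indicator_apply_eq_zero (f := fun x => fderiv ℝ f x e)).2 fun _ => hzero t fun h' => hy h'.1

end ObliqueCoordinates

/-! ### The domain as a subgraph near a boundary point. -/

section BoundaryChart

variable {d : ℕ}

/-- Points of V with ψ < 0 are interior to Ω, and those with ψ > 0 have a neighbourhood missing Ω.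
-/
theorem eq_zero_of_mem_frontier {Ω V : Set (Space d)} {ψ : Space d → ℝ} (hψ : Continuous ψ)
    (hV : IsOpen V) (hΩ : ∀ x ∈ V, (x ∈ Ω ↔ ψ x < 0)) {x : Space d} (hxV : x ∈ V)
    (hx : x ∈ frontier Ω) : ψ x = 0 := by
  rcases lt_trichotomy (ψ x) 0 with h | h | h
  · refine absurd (mem_interior.2 ⟨V ∩ {z | ψ z < 0}, fun z hz => (hΩ z hz.1).2 hz.2,
      hV.inter (isOpen_lt hψ continuous_const), hxV, h⟩) hx.2
  · exact h
  · obtain ⟨z, hz, hz'⟩ := mem_closure_iff.1 hx.1 (V ∩ {z | 0 < ψ z})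
      (hV.inter (isOpen_lt continuous_const hψ)) ⟨hxV, h⟩
    exact absurd ((hΩ z hz.1).1 hz') (not_lt.2 (le_of_lt hz.2))

/-- Near a boundary point with normal direction `N`, the domain is a subgraph over `N^⊥` in every
direction `e` with `⟪N, e⟫ = 1`, and the boundary is almost orthogonal to `N`. -/
theorem IsLocalDefiningFunction.exists_subgraph {Ω : Set (Space d)} {p : Space d}
    {ψ : Space d → ℝ} (hψ : IsLocalDefiningFunction Ω p ψ) {N e : Space d}
    (hN : gradient ψ p = ‖gradient ψ p‖ • N) (he : ⟪N, e⟫ = 1)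
    {η : ℝ} (hη : 0 < η) (hηe : η * (1 + ‖e‖) < 1)
    {F : Type*} [NormedAddCommGroup F] [InnerProductSpace ℝ F] {ι : F →ₗᵢ[ℝ] Space d}
    (hι : ∀ y, ⟪N, ι y⟫ = 0) :
    ∃ h : ℝ, 0 < h ∧ ∃ γ : F → ℝ, (∀ y, ‖y‖ < h → |γ y| < h) ∧
      (∀ y, ‖y‖ < h → ∀ t, |t| < h → (p + ι y + t • e ∈ Ω ↔ t < γ y)) ∧
      (∀ y, ‖y‖ < h → ∀ t, |t| < h → (p + ι y + t • e ∈ frontier Ω ↔ t = γ y)) ∧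
      ∀ x ∈ frontier Ω ∩ obliqueBox p N e h, ∀ x' ∈ frontier Ω ∩ obliqueBox p N e h,
        |⟪N, x - x'⟫| ≤ η * ‖x - x'‖ := by
  obtain ⟨hsm, hp, hg, hev⟩ := hψ
  set a := ‖gradient ψ p‖ with ha
  have hapos : 0 < a := norm_pos_iff.2 hg
  have hstrict : HasStrictFDerivAt ψ (fderiv ℝ ψ p) p :=
    hsm.contDiffAt.hasStrictFDerivAt (by simp)
  have hfd : ∀ v, fderiv ℝ ψ p v = a * ⟪N, v⟫ := by
    intro v
    rw [← inner_gradient_left, hN, inner_smul_left]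
    rfl
  -- Strict differentiability gives a two-point estimate: monotonicity along e and the
  -- near-orthogonality of the boundary to N both compare two points different from p.
  obtain ⟨R, hR, hball⟩ := Metric.eventually_nhds_iff_ball.1
    (hstrict.isLittleO.def (c := η * a) (by positivity))
  obtain ⟨R', hR', hball'⟩ := Metric.eventually_nhds_iff_ball.1 hev
  have hlin : ∀ x ∈ Metric.ball p R, ∀ x' ∈ Metric.ball p R,
      |ψ x - ψ x' - a * ⟪N, x - x'⟫| ≤ η * a * ‖x - x'‖ := by
    intro x hx x' hx'
    have := hball (x, x') (by rw [← ball_prod_same]; exact ⟨hx, hx'⟩)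
    simpa only [hfd, Real.norm_eq_abs] using this
  set r := min R R' with hr
  have hrpos : 0 < r := lt_min hR hR'
  have hrR : Metric.ball p r ⊆ Metric.ball p R := Metric.ball_subset_ball (min_le_left _ _)
  have hrR' : Metric.ball p r ⊆ Metric.ball p R' := Metric.ball_subset_ball (min_le_right _ _)
  have hΩr : ∀ x ∈ Metric.ball p r, (x ∈ Ω ↔ ψ x < 0) := fun x hx => hball' x (hrR' hx)
  -- Small enough that h (1 + ‖e‖) < r, so the whole closed segment |t| ≤ h over ‖y‖ < h stays in
  -- the ball.
  set h := r / (2 + ‖e‖) with hh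
  have hhpos : 0 < h := by positivity
  have hhr : h * (1 + ‖e‖) < r := by
    have : h * (2 + ‖e‖) = r := by rw [hh]; field_simp
    nlinarith
  have hin : ∀ y : F, ‖y‖ < h → ∀ t, |t| ≤ h → p + ι y + t • e ∈ Metric.ball p r := by
    intro y hy t ht
    rw [mem_ball_iff_norm, show p + ι y + t • e - p = ι y + t • e by abel]
    have h1 : ‖ι y + t • e‖ ≤ ‖y‖ + |t| * ‖e‖ := by
      simpa [norm_smul] using norm_add_le (ι y) (t • e)
    nlinarith [mul_le_mul_of_nonneg_right ht (norm_nonneg e)]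
  have hbox : obliqueBox p N e h ⊆ Metric.ball p r := by
    intro x hx
    rw [mem_ball_iff_norm]
    have h1 : ‖x - p‖ ≤ ‖x - p - ⟪N, x - p⟫ • e‖ + |⟪N, x - p⟫| * ‖e‖ := by
      simpa [norm_smul] using norm_add_le (x - p - ⟪N, x - p⟫ • e) (⟪N, x - p⟫ • e)
    nlinarith [mul_le_mul_of_nonneg_right hx.2.le (norm_nonneg e), hx.1]
  have hpr : p ∈ Metric.ball p r := Metric.mem_ball_self hrpos
  have hmono : ∀ y : F, ‖y‖ < h → StrictMonoOn (fun t : ℝ => ψ (p + ι y + t • e)) (Icc (-h) h) := by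
    intro y hy t ht t' ht' htt
    have h1 := hlin _ (hrR (hin y hy t' (abs_le.2 ht'))) _ (hrR (hin y hy t (abs_le.2 ht)))
    rw [show p + ι y + t' • e - (p + ι y + t • e) = (t' - t) • e by rw [sub_smul]; abel,
      inner_smul_right, he, norm_smul, Real.norm_eq_abs, abs_of_pos (sub_pos.2 htt)] at h1
    have h2 := (abs_le.1 h1).1
    have h3 : 0 < a * (t' - t) * (1 - η * ‖e‖) :=
      mul_pos (mul_pos hapos (sub_pos.2 htt)) (by nlinarith)
    change ψ (p + ι y + t • e) < ψ (p + ι y + t' • e)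
    nlinarith
  -- Hence ψ is positive at t = h and negative at t = -h, and the intermediate value theorem gives γ
  -- y.
  have hend : ∀ y : F, ‖y‖ < h → ∀ t, |t| = h →
      |ψ (p + ι y + t • e) - a * t| < a * h := by
    intro y hy t ht
    have h1 := hlin _ (hrR (hin y hy t ht.le)) _ (hrR hpr)
    rw [hp, inner_oblique he hι, show p + ι y + t • e - p = ι y + t • e by abel, sub_zero] at h1
    have h2 : ‖ι y + t • e‖ ≤ ‖y‖ + |t| * ‖e‖ := by
      simpa [norm_smul] using norm_add_le (ι y) (t • e)
    rw [ht] at h2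
    calc _ ≤ η * a * ‖ι y + t • e‖ := h1
      _ ≤ η * a * (h * (1 + ‖e‖)) := by gcongr; linarith
      _ = a * h * (η * (1 + ‖e‖)) := by ring
      _ < a * h * 1 := by gcongr
      _ = a * h := mul_one _
  have hroot : ∀ y : F, ‖y‖ < h → ∃ t, |t| < h ∧ ψ (p + ι y + t • e) = 0 := by
    intro y hy
    have h1 := (abs_lt.1 (hend y hy h (abs_of_pos hhpos))).1
    have h2 := (abs_lt.1 (hend y hy (-h) (by rw [abs_neg, abs_of_pos hhpos]))).2
    have hc : ContinuousOn (fun t : ℝ => ψ (p + ι y + t • e)) (Icc (-h) h) :=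
      (hsm.continuous.comp (by fun_prop)).continuousOn
    obtain ⟨t, ht, ht0⟩ := intermediate_value_Ioo (by linarith) hc
      (show (0 : ℝ) ∈ Ioo _ _ from ⟨by linarith, by linarith⟩)
    exact ⟨t, abs_lt.2 ht, ht0⟩
  choose! γ hγ1 hγ2 using hroot
  refine ⟨h, hhpos, γ, hγ1, ?_, ?_, ?_⟩
  · intro y hy t ht
    rw [hΩr _ (hin y hy t ht.le), ← hγ2 y hy]
    exact (hmono y hy).lt_iff_lt (abs_le.1 ht.le) (abs_le.1 (hγ1 y hy).le)
  · intro y hy t ht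
    constructor
    · intro hfr
      exact (hmono y hy).injOn (abs_le.1 ht.le) (abs_le.1 (hγ1 y hy).le)
        ((eq_zero_of_mem_frontier hsm.continuous Metric.isOpen_ball hΩr (hin y hy t ht.le)
          hfr).trans (hγ2 y hy).symm)
    · rintro rfl
      refine ⟨?_, fun hi => ?_⟩
      · have hcl : γ y ∈ closure (Ioo (-h) (γ y)) := by
          rw [closure_Ioo (abs_lt.1 ht).1.ne]
          exact ⟨(abs_lt.1 ht).1.le, le_rfl⟩
        refine map_mem_closure (f := fun t : ℝ => p + ι y + t • e) (by fun_prop) hcl fun s hs => ?_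
        have hs' : |s| ≤ h := abs_le.2 ⟨hs.1.le, hs.2.le.trans (abs_lt.1 ht).2.le⟩
        rw [hΩr _ (hin y hy s hs'), ← hγ2 y hy]
        exact hmono y hy (abs_le.1 hs') (abs_le.1 ht.le) hs.2
      · exact absurd ((hΩr _ (hin y hy _ ht.le)).1 (interior_subset hi)) (by simp [hγ2 y hy])
  · rintro x ⟨hx, hxb⟩ x' ⟨hx', hxb'⟩
    have h1 := hlin x (hrR (hbox hxb)) x' (hrR (hbox hxb'))
    rw [eq_zero_of_mem_frontier hsm.continuous Metric.isOpen_ball hΩr (hbox hxb) hx,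
      eq_zero_of_mem_frontier hsm.continuous Metric.isOpen_ball hΩr (hbox hxb') hx',
      sub_self, zero_sub, abs_neg, abs_mul, abs_of_pos hapos] at h1
    nlinarith

end BoundaryChart

/-! ### Hausdorff measure under almost isometric maps. -/

section HausdorffComparison

theorem euclideanHausdorffMeasure_image_le {X Y : Type*} [MetricSpace X]
    [MeasurableSpace X] [BorelSpace X] [MetricSpace Y] [MeasurableSpace Y] [BorelSpace Y]
    {K : NNReal} {f : X → Y} {s : Set X} (h : LipschitzOnWith K f s) (m : ℕ) :
    (μHE[m] : Measure Y) (f '' s) ≤ (K ^ m : NNReal) * (μHE[m] : Measure X) s := by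
  have := h.hausdorffMeasure_image_le (d := m) (by positivity)
  rw [Measure.euclideanHausdorffMeasure_def, Measure.euclideanHausdorffMeasure_def,
    Measure.smul_apply, Measure.smul_apply, ENNReal.smul_def, ENNReal.smul_def, smul_eq_mul,
    smul_eq_mul, mul_left_comm]
  gcongr
  simpa using this

/-- The expansion bound makes f injective on s with a K-Lipschitz inverse, to which the upper bound
applies. -/
theorem le_euclideanHausdorffMeasure_image {X Y : Type*} [MetricSpace X]
    [MeasurableSpace X] [BorelSpace X] [MetricSpace Y] [MeasurableSpace Y] [BorelSpace Y]
    {K : NNReal} {f : X → Y} {s : Set X} (h : ∀ x ∈ s, ∀ y ∈ s, dist x y ≤ K * dist (f x) (f y))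
    (m : ℕ) :
    (μHE[m] : Measure X) s ≤ (K ^ m : NNReal) * (μHE[m] : Measure Y) (f '' s) := by
  rcases s.eq_empty_or_nonempty with rfl | ⟨x₀, hx₀⟩
  · simp
  have : Nonempty X := ⟨x₀⟩
  have hinj : InjOn f s := fun x hx y hy hxy => by
    have := h x hx y hy
    rw [hxy, dist_self, mul_zero] at this
    exact dist_le_zero.1 this
  have hL : LipschitzOnWith K (Function.invFunOn f s) (f '' s) := by
    refine LipschitzOnWith.of_dist_le_mul ?_
    rintro _ ⟨x, hx, rfl⟩ _ ⟨y, hy, rfl⟩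
    rw [hinj.leftInvOn_invFunOn hx, hinj.leftInvOn_invFunOn hy]
    exact h x hx y hy
  simpa [hinj.leftInvOn_invFunOn.image_image] using euclideanHausdorffMeasure_image_le hL m

/-- Push-forward of Lebesgue measure by a map which is almost isometric on `D`. -/
theorem map_restrict_comparable {m : ℕ} {X : Type*} [MetricSpace X] [MeasurableSpace X]
    [BorelSpace X] {Φ : EuclideanSpace ℝ (Fin m) → X} {D : Set (EuclideanSpace ℝ (Fin m))}
    (hD : MeasurableSet D) {K : NNReal}
    (h1 : ∀ y ∈ D, ∀ y' ∈ D, dist (Φ y) (Φ y') ≤ K * dist y y')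
    (h2 : ∀ y ∈ D, ∀ y' ∈ D, dist y y' ≤ K * dist (Φ y) (Φ y')) :
    (volume.restrict D).map Φ ≤ (K ^ m) • (μHE[m] : Measure X).restrict (Φ '' D) ∧
      (μHE[m] : Measure X).restrict (Φ '' D) ≤ (K ^ m) • (volume.restrict D).map Φ := by
  have hL : LipschitzOnWith K Φ D := LipschitzOnWith.of_dist_le_mul h1
  have hae : AEMeasurable Φ (volume.restrict D) := hL.continuousOn.aemeasurable hD
  have himg : ∀ B, Φ '' (Φ ⁻¹' B ∩ D) = B ∩ Φ '' D := fun B => image_preimage_inter Φ D B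
  rw [← EuclideanSpace.euclideanHausdorffMeasure_eq_volume] at hae ⊢
  constructor <;> refine Measure.le_iff.2 fun B hB => ?_ <;>
    rw [Measure.smul_apply, Measure.map_apply_of_aemeasurable hae hB, Measure.restrict_apply' hD,
      Measure.restrict_apply hB, ← himg, ENNReal.smul_def, smul_eq_mul]
  · exact le_euclideanHausdorffMeasure_image (fun y hy y' hy' => h2 y hy.2 y' hy'.2) m
  · exact euclideanHausdorffMeasure_image_le (hL.mono inter_subset_right) m

/-- Both integrals are nonnegative and within a factor 1 + ε of each other. The error is relative to
the integral of f, which is what lets it be summed later. -/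
theorem abs_integral_sub_le_of_comparable {X : Type*} [TopologicalSpace X] [MeasurableSpace X]
    [BorelSpace X] {ν κ : Measure X} [IsFiniteMeasure ν] {c : NNReal} {ε : ℝ}
    (hc : (c : ℝ) ≤ 1 + ε) (hε : 0 ≤ ε) (hνκ : ν ≤ c • κ) (hκν : κ ≤ c • ν) {f : X → ℝ}
    (hf : Continuous f) (hfc : HasCompactSupport f) (h0 : 0 ≤ᵐ[κ] f) :
    |∫ x, f x ∂ν - ∫ x, f x ∂κ| ≤ ε * ∫ x, f x ∂κ := by
  have hfin : IsFiniteMeasure κ := isFiniteMeasure_of_le _ hκν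
  have hiν : Integrable f ν := hf.integrable_of_hasCompactSupport hfc
  have hiκ : Integrable f κ := hf.integrable_of_hasCompactSupport hfc
  have hκpos : 0 ≤ ∫ x, f x ∂κ := integral_nonneg_of_ae h0
  have h0ν : 0 ≤ᵐ[ν] f :=
    (Measure.absolutelyContinuous_of_le hνκ).trans Measure.smul_absolutelyContinuous h0
  have h1 : ∫ x, f x ∂ν ≤ c * ∫ x, f x ∂κ := by
    have := integral_mono_measure hνκ (Measure.smul_absolutelyContinuous h0)
      (hiκ.smul_measure_nnreal)
    rwa [integral_smul_nnreal_measure, NNReal.smul_def, smul_eq_mul] at this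
  have h2 : ∫ x, f x ∂κ ≤ c * ∫ x, f x ∂ν := by
    have := integral_mono_measure hκν (Measure.smul_absolutelyContinuous h0ν)
      (hiν.smul_measure_nnreal)
    rwa [integral_smul_nnreal_measure, NNReal.smul_def, smul_eq_mul] at this
  have hνpos : 0 ≤ ∫ x, f x ∂ν := integral_nonneg_of_ae h0ν
  rw [abs_le]
  constructor <;> nlinarith

end HausdorffComparison

/-! ### The local divergence theorem, up to a small relative error. -/

section LocalDivergence

variable {d : ℕ}

theorem exists_isometry_orthogonal (hd : 1 ≤ d) {N : Space d} (hN : ‖N‖ = 1) :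
    ∃ ι : EuclideanSpace ℝ (Fin (d - 1)) →ₗᵢ[ℝ] Space d, ∀ y, ⟪N, ι y⟫ = 0 := by
  have : Fact (Module.finrank ℝ (Space d) = (d - 1) + 1) :=
    ⟨by rw [finrank_euclideanSpace_fin]; omega⟩
  have hN0 : N ≠ 0 := fun h => by simp [h] at hN
  let b := OrthonormalBasis.fromOrthogonalSpanSingleton (𝕜 := ℝ) (d - 1) hN0
  exact ⟨(Submodule.subtypeₗᵢ _).comp b.repr.symm.toLinearIsometry,
    fun y => Submodule.mem_orthogonal_singleton_iff_inner_right.1 (b.repr.symm y).2⟩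

theorem exists_gt_one_pow_le (m : ℕ) {ε : ℝ} (hε : 0 < ε) :
    ∃ K : NNReal, 1 < K ∧ ((K ^ m : NNReal) : ℝ) ≤ 1 + ε := by
  have h : Tendsto (fun K : NNReal => ((K ^ m : NNReal) : ℝ)) (𝓝[>] 1) (𝓝 1) := by
    have : Continuous fun K : NNReal => ((K ^ m : NNReal) : ℝ) := by fun_prop
    simpa using (this.tendsto 1).mono_left nhdsWithin_le_nhds
  obtain ⟨K, hK1, hK2⟩ := ((h.eventually_le_const (lt_add_of_pos_right 1 hε)).and
    self_mem_nhdsWithin).exists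
  exact ⟨K, hK2, hK1⟩

/-- The integral over Ω is exactly ∫ f(Φ y) dy for the graph map Φ. If the chart is small, Φ is
K-bi-Lipschitz with K^(d-1) ≤ 1 + ε, so replacing dy by the surface measure costs the stated error.
The comparison also shows that U has finite surface measure. -/
theorem IsLocalDefiningFunction.exists_nhds_approx (hd : 1 ≤ d) {Ω : Set (Space d)}
    (hΩ : MeasurableSet Ω) {p : Space d} {ψ : Space d → ℝ} (hψ : IsLocalDefiningFunction Ω p ψ)
    {N e : Space d} (hN1 : ‖N‖ = 1) (hN : gradient ψ p = ‖gradient ψ p‖ • N) (he : ⟪N, e⟫ = 1)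
    {ε : ℝ} (hε : 0 < ε) :
    ∃ U : Set (Space d), IsOpen U ∧ p ∈ U ∧ surfaceMeasure Ω U < ⊤ ∧
      ∀ f : Space d → ℝ, ContDiff ℝ 1 f → HasCompactSupport f → tsupport f ⊆ U →
        (∀ x ∈ frontier Ω, 0 ≤ f x) →
        |(∫ x in Ω, fderiv ℝ f x e) - ∫ x, f x ∂(surfaceMeasure Ω)| ≤
          ε * ∫ x, f x ∂(surfaceMeasure Ω) := by
  obtain ⟨ι, hι⟩ := exists_isometry_orthogonal hd hN1
  obtain ⟨K, hK1, hK⟩ := exists_gt_one_pow_le (d - 1) hε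
  have hK1' : (1 : ℝ) < K := hK1
  -- Chosen so that the displacement along e contributes at most the fraction 1 - K⁻¹ of dist (Φ y)
  -- (Φ y').
  set η : ℝ := (1 - (K : ℝ)⁻¹) / (1 + ‖e‖) with hη
  have hKinv : (K : ℝ)⁻¹ < 1 := inv_lt_one_of_one_lt₀ hK1'
  have hKinv0 : 0 < (K : ℝ)⁻¹ := by positivity
  have hηe : η * (1 + ‖e‖) = 1 - (K : ℝ)⁻¹ := by rw [hη]; field_simp
  have hηpos : 0 < η := div_pos (by linarith) (by positivity)
  obtain ⟨h, hh, γ, hγ1, hγ2, hγ3, hγ4⟩ :=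
    hψ.exists_subgraph hN he hηpos (by rw [hηe]; linarith) hι
  set Φ : EuclideanSpace ℝ (Fin (d - 1)) → Space d := fun y => p + ι y + γ y • e with hΦ
  have hmem : ∀ y ∈ Metric.ball (0 : EuclideanSpace ℝ (Fin (d - 1))) h,
      Φ y ∈ frontier Ω ∩ obliqueBox p N e h := by
    intro y hy
    rw [mem_ball_zero_iff] at hy
    exact ⟨(hγ3 y hy _ (hγ1 y hy)).2 rfl, (mem_obliqueBox_iff he hι _ _).2 ⟨hy, hγ1 y hy⟩⟩
  have hfr : Module.finrank ℝ (Space d) =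
      Module.finrank ℝ (EuclideanSpace ℝ (Fin (d - 1))) + 1 := by
    rw [finrank_euclideanSpace_fin, finrank_euclideanSpace_fin]; omega
  have himg : Φ '' Metric.ball 0 h = obliqueBox p N e h ∩ frontier Ω := by
    refine Subset.antisymm ?_ ?_
    · rintro _ ⟨y, hy, rfl⟩
      exact (hmem y hy).symm
    · rintro x ⟨hxb, hx⟩
      obtain ⟨y, hy⟩ := exists_eq_of_inner_eq_zero hN1 hι hfr
        (x := x - p - ⟪N, x - p⟫ • e) (by rw [inner_sub_right _ _ (_ • e), inner_smul_right, he]; ring)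
      have hxy : x = p + ι y + ⟪N, x - p⟫ • e := by rw [hy]; abel
      have hb := hxb
      rw [hxy, mem_obliqueBox_iff he hι] at hb
      refine ⟨y, by simpa using hb.1, ?_⟩
      have := (hγ3 y hb.1 _ hb.2).1 (by rwa [← hxy])
      rw [hΦ]
      dsimp only
      rw [← this, ← hxy]
  have hdist : ∀ y ∈ Metric.ball (0 : EuclideanSpace ℝ (Fin (d - 1))) h,
      ∀ y' ∈ Metric.ball (0 : EuclideanSpace ℝ (Fin (d - 1))) h,
      |dist (Φ y) (Φ y') - dist y y'| ≤ (1 - (K : ℝ)⁻¹) * dist (Φ y) (Φ y') := by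
    intro y hy y' hy'
    have h1 := hγ4 _ (hmem y hy) _ (hmem y' hy')
    have h2 : Φ y - Φ y' = ι (y - y') + (γ y - γ y') • e := by
      simp only [hΦ, map_sub, sub_smul]; abel
    have h3 : ⟪N, Φ y - Φ y'⟫ = γ y - γ y' := by
      rw [h2, inner_add_right, hι, inner_smul_right, he]; ring
    have h4 := abs_norm_sub_norm_le (Φ y - Φ y') (ι (y - y'))
    rw [ι.norm_map, show Φ y - Φ y' - ι (y - y') = (γ y - γ y') • e by rw [h2]; abel, norm_smul,
      Real.norm_eq_abs, ← h3] at h4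
    rw [dist_eq_norm, dist_eq_norm, ← hηe]
    refine h4.trans ((mul_le_mul_of_nonneg_right h1 (norm_nonneg e)).trans ?_)
    have := mul_nonneg hηpos.le (norm_nonneg (Φ y - Φ y'))
    nlinarith
  have hKK : (K : ℝ) * (K : ℝ)⁻¹ = 1 := mul_inv_cancel₀ (by positivity)
  have hd1 : ∀ y ∈ Metric.ball (0 : EuclideanSpace ℝ (Fin (d - 1))) h,
      ∀ y' ∈ Metric.ball (0 : EuclideanSpace ℝ (Fin (d - 1))) h,
      dist (Φ y) (Φ y') ≤ K * dist y y' := fun y hy y' hy' => by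
    have := (abs_le.1 (hdist y hy y' hy')).2
    have h5 : (K : ℝ)⁻¹ * dist (Φ y) (Φ y') ≤ dist y y' := by linarith
    calc dist (Φ y) (Φ y') = K * ((K : ℝ)⁻¹ * dist (Φ y) (Φ y')) := by
          rw [← mul_assoc, hKK, one_mul]
      _ ≤ K * dist y y' := by gcongr
  have hL : LipschitzOnWith K Φ (Metric.ball 0 h) := LipschitzOnWith.of_dist_le_mul hd1
  obtain ⟨hc1, hc2⟩ := map_restrict_comparable (Φ := Φ) (D := Metric.ball 0 h)
    measurableSet_ball (K := K) hd1 (fun y hy y' hy' => by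
      have := (abs_le.1 (hdist y hy y' hy')).1
      -- This suffices because K + K⁻¹ ≥ 2.
      have h5 : dist y y' ≤ (2 - (K : ℝ)⁻¹) * dist (Φ y) (Φ y') := by linarith
      refine h5.trans ?_
      gcongr
      nlinarith [sq_nonneg ((K : ℝ) - 1)])
  have hopen : MeasurableSet (obliqueBox p N e h) := (isOpen_obliqueBox p N e h).measurableSet
  have hσ : (μHE[d - 1] : Measure (Space d)).restrict (Φ '' Metric.ball 0 h) =
      (surfaceMeasure Ω).restrict (obliqueBox p N e h) := by
    rw [surfaceMeasure, Measure.restrict_restrict hopen, himg]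
  rw [hσ] at hc1 hc2
  have hae : AEMeasurable Φ (volume.restrict (Metric.ball 0 h)) :=
    hL.continuousOn.aemeasurable measurableSet_ball
  have : IsFiniteMeasure (volume.restrict (Metric.ball (0 : EuclideanSpace ℝ (Fin (d - 1))) h)) :=
    ⟨by simpa using measure_ball_lt_top⟩
  have : IsFiniteMeasure ((volume.restrict (Metric.ball 0 h)).map Φ) :=
    Measure.isFiniteMeasure_map _ _
  refine ⟨obliqueBox p N e h, isOpen_obliqueBox p N e h, mem_obliqueBox_self p N e hh, ?_, ?_⟩
  · have : IsFiniteMeasure ((surfaceMeasure Ω).restrict (obliqueBox p N e h)) :=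
      isFiniteMeasure_of_le _ hc2
    simpa using measure_lt_top ((surfaceMeasure Ω).restrict (obliqueBox p N e h)) univ
  · intro f hf hfc hfs hf0
    have key : ∫ x in Ω, fderiv ℝ f x e = ∫ y in Metric.ball 0 h, f (Φ y) :=
      setIntegral_fderiv_subgraph hN1 he hι hfr hΩ hγ2 hf hfc hfs
    have hr : ∫ x, f x ∂(surfaceMeasure Ω) = ∫ x in obliqueBox p N e h, f x ∂(surfaceMeasure Ω) :=
      (setIntegral_eq_integral_of_forall_compl_eq_zero fun x hx =>
        image_eq_zero_of_notMem_tsupport fun h' => hx (hfs h')).symm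
    rw [key, hr,
      ← integral_map (φ := Φ) hae hf.continuous.aestronglyMeasurable]
    refine abs_integral_sub_le_of_comparable hK hε.le hc1 hc2 hf.continuous hfc ?_
    refine ae_restrict_of_ae ?_
    exact (ae_restrict_iff' isClosed_frontier.measurableSet).2 (Eventually.of_forall hf0)

end LocalDivergence

/-! ### The outer normal, and finiteness of the surface measure. -/

section Normal

variable {d : ℕ} {Ω : Set (Space d)} {p : Space d} {ψ χ : Space d → ℝ}

/-- A direction in which ψ decreases enters Ω, where χ < 0 = χ p; so the one-sided slope of χ is not
positive. -/
theorem IsLocalDefiningFunction.inner_gradient_nonpos (hψ : IsLocalDefiningFunction Ω p ψ)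
    (hχ : IsLocalDefiningFunction Ω p χ) {v : Space d} (hv : ⟪gradient ψ p, v⟫ < 0) :
    ⟪gradient χ p, v⟫ ≤ 0 := by
  have hder : ∀ g : Space d → ℝ, ContDiff ℝ ∞ g →
      HasDerivAt (fun t : ℝ => g (p + t • v)) ⟪gradient g p, v⟫ 0 := by
    intro g hg
    rw [inner_gradient_left]
    have h1 : HasDerivAt (fun t : ℝ => p + t • v) v 0 := by
      simpa using ((hasDerivAt_id (0 : ℝ)).smul_const v).const_add p
    have h2 : HasFDerivAt g (fderiv ℝ g p) (p + (0 : ℝ) • v) := by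
      rw [zero_smul, add_zero]
      exact (hg.differentiable (by simp) p).hasFDerivAt
    exact h2.comp_hasDerivAt 0 h1
  have hline : Tendsto (fun t : ℝ => p + t • v) (𝓝[>] 0) (𝓝 p) := by
    have : Continuous fun t : ℝ => p + t • v := by fun_prop
    simpa using (this.tendsto 0).mono_left (nhdsWithin_le_nhds (s := Ioi 0))
  have hψs := (hder ψ hψ.1).tendsto_slope_zero_right
  have hχs := (hder χ hχ.1).tendsto_slope_zero_right
  simp only [zero_add, zero_smul, add_zero, hψ.2.1, hχ.2.1, sub_zero, smul_eq_mul] at hψs hχs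
  refine le_of_tendsto hχs ?_
  filter_upwards [hψs.eventually_lt_const hv, hline.eventually hψ.2.2.2,
    hline.eventually hχ.2.2.2, self_mem_nhdsWithin] with t h1 h2 h3 h4
  have ht : 0 < t⁻¹ := inv_pos.2 h4
  have h5 : ψ (p + t • v) < 0 := by
    by_contra hcon
    exact absurd h1 (not_lt.2 (mul_nonneg ht.le (not_lt.1 hcon)))
  exact mul_nonpos_of_nonneg_of_nonpos ht.le (h3.1 (h2.2 h5)).le

/-- Were two normals n₁ ≠ n₂ possible, the direction n₂ - n₁ would point inward for the first and
outward for the second. -/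
theorem IsLocalDefiningFunction.outerNormal_eq (hψ : IsLocalDefiningFunction Ω p ψ) :
    outerNormal Ω p = ‖gradient ψ p‖⁻¹ • gradient ψ p := by
  have hex : ∃ ψ : Space d → ℝ, IsLocalDefiningFunction Ω p ψ := ⟨ψ, hψ⟩
  rw [outerNormal, dif_pos hex]
  have hχ := hex.choose_spec
  set χ := hex.choose
  set a := gradient ψ p
  set b := gradient χ p
  have ha : 0 < ‖a‖ := norm_pos_iff.2 hψ.2.2.1
  have hb : 0 < ‖b‖ := norm_pos_iff.2 hχ.2.2.1
  have hna : ‖‖a‖⁻¹ • a‖ = 1 := norm_smul_inv_norm hψ.2.2.1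
  have hnb : ‖‖b‖⁻¹ • b‖ = 1 := norm_smul_inv_norm hχ.2.2.1
  by_contra hne
  set n₁ := ‖a‖⁻¹ • a with hn₁
  set n₂ := ‖b‖⁻¹ • b with hn₂
  have hlt : ⟪n₁, n₂⟫ < 1 := (inner_lt_one_iff_real_of_norm_eq_one hna hnb).2 (Ne.symm hne)
  have h1 : ⟪a, n₂ - n₁⟫ < 0 := by
    have : a = ‖a‖ • n₁ := by rw [hn₁, smul_smul, mul_inv_cancel₀ ha.ne', one_smul]
    rw [this, inner_smul_left, inner_sub_right, real_inner_self_eq_norm_sq, hna]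
    exact mul_neg_of_pos_of_neg ha (by linarith)
  have h2 := hψ.inner_gradient_nonpos hχ h1
  have : gradient χ p = ‖b‖ • n₂ := by
    rw [hn₂, smul_smul, mul_inv_cancel₀ hb.ne', one_smul]
  rw [this, inner_smul_left, inner_sub_right, real_inner_self_eq_norm_sq, hnb,
    real_inner_comm] at h2
  have : 0 < ‖b‖ * (1 ^ 2 - ⟪n₁, n₂⟫) := mul_pos hb (by linarith)
  exact absurd h2 (not_le.2 this)

/-- One ψ serves all nearby boundary points, which gives continuity of the normal. -/
theorem IsLocalDefiningFunction.eventually (hψ : IsLocalDefiningFunction Ω p ψ) :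
    ∀ᶠ x in 𝓝 p, x ∈ frontier Ω → IsLocalDefiningFunction Ω x ψ := by
  obtain ⟨hsm, -, hg, hev⟩ := hψ
  have hcont : Continuous (gradient ψ) :=
    (InnerProductSpace.toDual ℝ (Space d)).symm.continuous.comp
      (hsm.continuous_fderiv (by simp))
  obtain ⟨r, hr, hball⟩ := Metric.eventually_nhds_iff_ball.1 hev
  filter_upwards [hcont.continuousAt.eventually_ne hg, Metric.ball_mem_nhds p hr] with x hx hxr hxf
  exact ⟨hsm, eq_zero_of_mem_frontier hsm.continuous Metric.isOpen_ball hball hxr hxf, hx,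
    mem_of_superset (Metric.isOpen_ball.mem_nhds hxr) hball⟩

theorem continuousOn_outerNormal (hΩ : IsSmoothBoundedDomain Ω) :
    ContinuousOn (outerNormal Ω) (frontier Ω) := by
  intro p hp
  obtain ⟨ψ, hψ⟩ := hΩ.2.2.2 p hp
  have hcont : Continuous (gradient ψ) :=
    (InnerProductSpace.toDual ℝ (Space d)).symm.continuous.comp
      (hψ.1.continuous_fderiv (by simp))
  have h1 : ContinuousAt (fun x => ‖gradient ψ x‖⁻¹ • gradient ψ x) p :=
    (hcont.continuousAt.norm.inv₀ (norm_ne_zero_iff.2 hψ.2.2.1)).smul hcont.continuousAt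
  refine h1.continuousWithinAt.congr_of_eventuallyEq ?_ hψ.outerNormal_eq
  filter_upwards [nhdsWithin_le_nhds hψ.eventually, self_mem_nhdsWithin] with x hx hxf
  exact (hx hxf).outerNormal_eq

theorem norm_outerNormal (hΩ : IsSmoothBoundedDomain Ω) (hp : p ∈ frontier Ω) :
    ‖outerNormal Ω p‖ = 1 := by
  obtain ⟨ψ, hψ⟩ := hΩ.2.2.2 p hp
  rw [hψ.outerNormal_eq]
  exact norm_smul_inv_norm hψ.2.2.1

theorem isCompact_frontier (hΩ : IsSmoothBoundedDomain Ω) : IsCompact (frontier Ω) :=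
  hΩ.2.2.1.isCompact_closure.of_isClosed_subset isClosed_frontier frontier_subset_closure

theorem exists_nhds_approx (hd : 1 ≤ d) (hΩ : IsSmoothBoundedDomain Ω) (hp : p ∈ frontier Ω)
    {e : Space d} (he : ⟪outerNormal Ω p, e⟫ = 1) {ε : ℝ} (hε : 0 < ε) :
    ∃ U : Set (Space d), IsOpen U ∧ p ∈ U ∧ surfaceMeasure Ω U < ⊤ ∧
      ∀ f : Space d → ℝ, ContDiff ℝ 1 f → HasCompactSupport f → tsupport f ⊆ U →
        (∀ x ∈ frontier Ω, 0 ≤ f x) →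
        |(∫ x in Ω, fderiv ℝ f x e) - ∫ x, f x ∂(surfaceMeasure Ω)| ≤
          ε * ∫ x, f x ∂(surfaceMeasure Ω) := by
  obtain ⟨ψ, hψ⟩ := hΩ.2.2.2 p hp
  refine hψ.exists_nhds_approx hd hΩ.1.measurableSet (norm_outerNormal hΩ hp) ?_ he hε
  rw [hψ.outerNormal_eq, smul_smul, mul_inv_cancel₀ (norm_ne_zero_iff.2 hψ.2.2.1), one_smul]

theorem isFiniteMeasure_surfaceMeasure (hd : 1 ≤ d) (hΩ : IsSmoothBoundedDomain Ω) :
    IsFiniteMeasure (surfaceMeasure Ω) := by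
  have h : surfaceMeasure Ω (frontier Ω) < ⊤ := by
    refine (isCompact_frontier hΩ).measure_lt_top_of_nhdsWithin fun p hp => ?_
    obtain ⟨U, hU, hpU, hlt, -⟩ := exists_nhds_approx hd hΩ hp (e := outerNormal Ω p)
      (by rw [real_inner_self_eq_norm_sq, norm_outerNormal hΩ hp, one_pow]) one_pos
    exact ⟨U, mem_nhdsWithin_of_mem_nhds (hU.mem_nhds hpU), hlt⟩
  refine ⟨?_⟩
  rw [surfaceMeasure, Measure.restrict_apply_self] at h
  rwa [surfaceMeasure, Measure.restrict_apply_univ]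

end Normal

/-! ### The global divergence theorem. -/

section Divergence

variable {d : ℕ} {Ω : Set (Space d)} {p : Space d}

theorem integrable_surfaceMeasure (hd : 1 ≤ d) (hΩ : IsSmoothBoundedDomain Ω)
    {f : Space d → ℝ} (hf : ContinuousOn f (frontier Ω)) : Integrable f (surfaceMeasure Ω) := by
  have := isFiniteMeasure_surfaceMeasure hd hΩ
  have hlt : surfaceMeasure Ω (frontier Ω) ≠ ⊤ := measure_ne_top _ _
  have h := hf.integrableOn_of_subset_isCompact (μ := surfaceMeasure Ω)
    (isCompact_frontier hΩ) isClosed_frontier.measurableSet Subset.rfl hlt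
  rwa [IntegrableOn, surfaceMeasure, Measure.restrict_restrict isClosed_frontier.measurableSet,
    inter_self] at h

theorem setIntegral_surfaceMeasure_congr {f g : Space d → ℝ} (h : ∀ x ∈ frontier Ω, f x = g x) :
    ∫ x, f x ∂(surfaceMeasure Ω) = ∫ x, g x ∂(surfaceMeasure Ω) :=
  integral_congr_ae <| (ae_restrict_iff' isClosed_frontier.measurableSet).2 (Eventually.of_forall h)

/-- The local result requires inner product 1 with N, so a general e, even a tangential one, is
written as a combination of e + (1 - c)N and N, where c = ⟪N, e⟫. This yields c ∫ f dσ, and c is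
close to ⟪e, ν(x)⟫ near p by continuity of ν. -/
theorem exists_nhds_divergence_approx (hd : 1 ≤ d) (hΩ : IsSmoothBoundedDomain Ω)
    (hp : p ∈ frontier Ω) (e : Space d) {ε : ℝ} (hε : 0 < ε) :
    ∃ U : Set (Space d), IsOpen U ∧ p ∈ U ∧
      ∀ f : Space d → ℝ, ContDiff ℝ 1 f → HasCompactSupport f → tsupport f ⊆ U →
        (∀ x ∈ frontier Ω, 0 ≤ f x) →
        |(∫ x in Ω, fderiv ℝ f x e) - ∫ x, f x * ⟪e, outerNormal Ω x⟫ ∂(surfaceMeasure Ω)| ≤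
          ε * ∫ x, f x ∂(surfaceMeasure Ω) := by
  set N := outerNormal Ω p with hN
  have hN1 : ⟪N, N⟫ = 1 := by rw [real_inner_self_eq_norm_sq, norm_outerNormal hΩ hp, one_pow]
  set c := ⟪N, e⟫ with hc
  set δ := ε / 2 / (1 + |c - 1|) with hδ
  have hδpos : 0 < δ := by positivity
  obtain ⟨U₁, hU₁, hp₁, -, h₁⟩ := exists_nhds_approx hd hΩ hp (e := e + (1 - c) • N)
    (by rw [inner_add_right, inner_smul_right, hN1, ← hc]; ring) hδpos
  obtain ⟨U₂, hU₂, hp₂, -, h₂⟩ := exists_nhds_approx hd hΩ hp hN1 hδpos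
  have hcont : ContinuousOn (fun x => ⟪e, outerNormal Ω x⟫) (frontier Ω) :=
    continuousOn_const.inner (continuousOn_outerNormal hΩ)
  obtain ⟨U₃, hU₃, hp₃, h₃⟩ := (continuousOn_iff'.1 hcont) (Metric.ball c (ε / 2)) Metric.isOpen_ball
    |> fun ⟨U, hU, hUeq⟩ => (⟨U, hU, (hUeq.le ⟨by
      rw [mem_preimage, ← hN, real_inner_comm, ← hc]; exact Metric.mem_ball_self (by positivity),
      hp⟩).1, fun x hx hxf => (hUeq.ge ⟨hx, hxf⟩).1⟩ : ∃ U, IsOpen U ∧ p ∈ U ∧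
        ∀ x ∈ U, x ∈ frontier Ω → ⟪e, outerNormal Ω x⟫ ∈ Metric.ball c (ε / 2))
  refine ⟨U₁ ∩ U₂ ∩ U₃, (hU₁.inter hU₂).inter hU₃, ⟨⟨hp₁, hp₂⟩, hp₃⟩, ?_⟩
  intro f hf hfc hfs hf0
  have g₁ := h₁ f hf hfc (hfs.trans fun x hx => hx.1.1) hf0
  have g₂ := h₂ f hf hfc (hfs.trans fun x hx => hx.1.2) hf0
  have hint : ∀ v, IntegrableOn (fun x => fderiv ℝ f x v) Ω := fun v =>
    (((hf.continuous_fderiv one_ne_zero).clm_apply continuous_const).integrable_of_hasCompactSupport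
      (hfc.fderiv_apply (𝕜 := ℝ) v)).integrableOn
  have hsplit : ∫ x in Ω, fderiv ℝ f x (e + (1 - c) • N) =
      (∫ x in Ω, fderiv ℝ f x e) + (1 - c) * ∫ x in Ω, fderiv ℝ f x N := by
    simp only [map_add, map_smul, smul_eq_mul]
    rw [integral_add (hint e) ((hint N).const_mul _), integral_const_mul]
  rw [hsplit] at g₁
  set I := ∫ x, f x ∂(surfaceMeasure Ω) with hI
  have hIi : Integrable f (surfaceMeasure Ω) :=
    integrable_surfaceMeasure hd hΩ hf.continuous.continuousOn
  have hIe : Integrable (fun x => f x * ⟪e, outerNormal Ω x⟫) (surfaceMeasure Ω) :=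
    integrable_surfaceMeasure hd hΩ (hf.continuous.continuousOn.mul hcont)
  have hI0 : 0 ≤ I := integral_nonneg_of_ae <|
    (ae_restrict_iff' isClosed_frontier.measurableSet).2 (Eventually.of_forall hf0)
  have g₃ : |c * I - ∫ x, f x * ⟪e, outerNormal Ω x⟫ ∂(surfaceMeasure Ω)| ≤ ε / 2 * I := by
    rw [hI, ← integral_const_mul, ← integral_const_mul, ← integral_sub (hIi.const_mul c) hIe]
    refine (abs_integral_le_integral_abs).trans
      (integral_mono_ae ((hIi.const_mul c).sub hIe).abs (hIi.const_mul _) ?_)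
    refine (ae_restrict_iff' isClosed_frontier.measurableSet).2 (Eventually.of_forall ?_)
    intro x hx
    dsimp only
    rw [show c * f x - f x * ⟪e, outerNormal Ω x⟫ = f x * (c - ⟪e, outerNormal Ω x⟫) by ring,
      abs_mul, abs_of_nonneg (hf0 x hx), mul_comm]
    by_cases hxU : x ∈ tsupport f
    · have := h₃ x (hfs hxU).2 hx
      rw [Metric.mem_ball, dist_comm, Real.dist_eq] at this
      exact mul_le_mul_of_nonneg_right this.le (hf0 x hx)
    · simp [image_eq_zero_of_notMem_tsupport hxU]
  have hδe : δ * (1 + |c - 1|) = ε / 2 := by rw [hδ]; field_simp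
  set A := ∫ x in Ω, fderiv ℝ f x e
  set B := ∫ x in Ω, fderiv ℝ f x N
  set J := ∫ x, f x * ⟪e, outerNormal Ω x⟫ ∂(surfaceMeasure Ω)
  have h4 : A - J = (A + (1 - c) * B - I) + (c - 1) * (B - I) + (c * I - J) := by ring
  have h5 : |(c - 1) * (B - I)| ≤ |c - 1| * (δ * I) := by
    rw [abs_mul]; exact mul_le_mul_of_nonneg_left g₂ (abs_nonneg _)
  calc |A - J| ≤ |A + (1 - c) * B - I| + |(c - 1) * (B - I)| + |c * I - J| := by
        rw [h4]; exact abs_add_three _ _ _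
    _ ≤ δ * I + |c - 1| * (δ * I) + ε / 2 * I := by gcongr
    _ = (δ * (1 + |c - 1|) + ε / 2) * I := by ring
    _ = ε * I := by rw [hδe]; ring

theorem integral_fderiv_apply_eq_zero {E : Type*} [NormedAddCommGroup E] [NormedSpace ℝ E]
    [FiniteDimensional ℝ E] [MeasurableSpace E] [BorelSpace E] (μ : Measure E) [μ.IsAddHaarMeasure]
    {f : E → ℝ} (hf : ContDiff ℝ 1 f) (hfc : HasCompactSupport f) (e : E) :
    ∫ x, fderiv ℝ f x e ∂μ = 0 := by
  have hi : Integrable (fun x => fderiv ℝ f x e) μ :=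
    ((hf.continuous_fderiv one_ne_zero).clm_apply continuous_const).integrable_of_hasCompactSupport
      (hfc.fderiv_apply (𝕜 := ℝ) e)
  have hif : Integrable f μ := hf.continuous.integrable_of_hasCompactSupport hfc
  have := integral_mul_fderiv_eq_neg_fderiv_mul_of_integrable (μ := μ) (f := fun _ : E => (1 : ℝ))
    (g := f) (v := e) (by simp) (by simpa using hi) (by simpa using hif)
    (fun x _ => differentiableAt_const _) (fun x _ => hf.differentiable one_ne_zero x)
  simpa using this

theorem integral_divergence_of_tsupport_subset (hΩ : IsOpen Ω) {f : Space d → ℝ}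
    (hf : ContDiff ℝ 1 f) (hfc : HasCompactSupport f) (hfs : tsupport f ⊆ Ω) (e : Space d) :
    (∫ x in Ω, fderiv ℝ f x e) = 0 ∧ ∀ x ∈ frontier Ω, f x = 0 := by
  refine ⟨?_, fun x hx => image_eq_zero_of_notMem_tsupport fun h => ?_⟩
  · rw [setIntegral_eq_integral_of_forall_compl_eq_zero]
    · exact integral_fderiv_apply_eq_zero _ hf hfc e
    · intro x hx
      rw [fderiv_of_notMem_tsupport ℝ fun h => hx (hfs h)]
      rfl
  · rw [hΩ.frontier_eq] at hx
    exact hx.2 (hfs h)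

/-- A partition of unity splits f into pieces nonnegative on the boundary. The local errors are
bounded by ε times integrals of the pieces, which sum to ε ∫ f dσ; the same ε works for every cover.
-/
theorem abs_divergence_sub_le (hd : 1 ≤ d) (hΩ : IsSmoothBoundedDomain Ω) {f : Space d → ℝ}
    (hf : ContDiff ℝ 1 f) (hf0 : ∀ x ∈ frontier Ω, 0 ≤ f x) (e : Space d) {ε : ℝ} (hε : 0 < ε) :
    |(∫ x in Ω, fderiv ℝ f x e) - ∫ x, f x * ⟪e, outerNormal Ω x⟫ ∂(surfaceMeasure Ω)| ≤
      ε * ∫ x, f x ∂(surfaceMeasure Ω) := by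
  have hloc : ∀ p ∈ closure Ω, ∃ U : Set (Space d), IsOpen U ∧ p ∈ U ∧ Bornology.IsBounded U ∧
      ∀ g : Space d → ℝ, ContDiff ℝ 1 g → HasCompactSupport g → tsupport g ⊆ U →
        (∀ x ∈ frontier Ω, 0 ≤ g x) →
        |(∫ x in Ω, fderiv ℝ g x e) - ∫ x, g x * ⟪e, outerNormal Ω x⟫ ∂(surfaceMeasure Ω)| ≤
          ε * ∫ x, g x ∂(surfaceMeasure Ω) := by
    intro p hp
    by_cases hpΩ : p ∈ Ω
    · refine ⟨Ω, hΩ.1, hpΩ, hΩ.2.2.1, fun g hg hgc hgs hg0 => ?_⟩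
      obtain ⟨h1, h2⟩ := integral_divergence_of_tsupport_subset hΩ.1 hg hgc hgs e
      rw [h1, setIntegral_surfaceMeasure_congr (g := 0) (fun x hx => by simp [h2 x hx]),
        setIntegral_surfaceMeasure_congr (g := 0) h2]
      simp
    · obtain ⟨U, hU, hpU, h⟩ := exists_nhds_divergence_approx hd hΩ
        (by rw [hΩ.1.frontier_eq]; exact ⟨hp, hpΩ⟩) e hε
      exact ⟨U ∩ Metric.ball p 1, hU.inter Metric.isOpen_ball, ⟨hpU, Metric.mem_ball_self one_pos⟩,
        Metric.isBounded_ball.subset inter_subset_right,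
        fun g hg hgc hgs => h g hg hgc (hgs.trans inter_subset_left)⟩
  choose! U hUo hpU hUb hU using hloc
  obtain ⟨t, ht, hcov⟩ := hΩ.2.2.1.isCompact_closure.elim_nhds_subcover U
    fun p hp => (hUo p hp).mem_nhds (hpU p hp)
  obtain ⟨χ, hχ⟩ := SmoothPartitionOfUnity.exists_isSubordinate (modelWithCornersSelf ℝ (Space d))
    (isClosed_closure (s := Ω)) (fun i : t => U i) (fun i => hUo i (ht i i.2))
    (by simpa [iUnion_subtype] using hcov)
  have hsum : ∀ x ∈ closure Ω, ∑ i, χ i x = 1 := fun x hx => by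
    rw [← finsum_eq_sum_of_fintype]; exact χ.sum_eq_one hx
  have hχs : ∀ i, ContDiff ℝ 1 (fun x => χ i x) := fun i =>
    ((χ i).contMDiff.contDiff).of_le (by simp)
  set g : t → Space d → ℝ := fun i x => χ i x * f x with hg
  have hgs : ∀ i, ContDiff ℝ 1 (g i) := fun i => (hχs i).mul hf
  have hgsub : ∀ i, tsupport (g i) ⊆ U i := fun i => (tsupport_mul_subset_left).trans (hχ i)
  have hgc : ∀ i, HasCompactSupport (g i) := fun i =>
    Metric.isCompact_of_isClosed_isBounded (isClosed_tsupport _)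
      ((hUb i (ht i i.2)).subset (hgsub i))
  have hg0 : ∀ i, ∀ x ∈ frontier Ω, 0 ≤ g i x := fun i x hx =>
    mul_nonneg (χ.nonneg i x) (hf0 x hx)
  have hgi := fun i : t => hU i (ht i i.2) (g i) (hgs i) (hgc i) (hgsub i) (hg0 i)
  have hfsum : ∀ x ∈ closure Ω, f x = ∑ i, g i x := fun x hx => by
    rw [hg, ← Finset.sum_mul, hsum x hx, one_mul]
  have hcont : ContinuousOn (fun x => ⟪e, outerNormal Ω x⟫) (frontier Ω) :=
    continuousOn_const.inner (continuousOn_outerNormal hΩ)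
  have e1 : ∫ x in Ω, fderiv ℝ f x e = ∑ i, ∫ x in Ω, fderiv ℝ (g i) x e := by
    rw [← integral_finsetSum]
    · refine setIntegral_congr_fun hΩ.1.measurableSet fun x hx => ?_
      -- The partition sums to 1 only on the closure, which contains a neighbourhood of x ∈ Ω, so
      -- derivatives agree there.
      have : f =ᶠ[𝓝 x] fun x => ∑ i, g i x := by
        filter_upwards [hΩ.1.mem_nhds hx] with y hy using hfsum y (subset_closure hy)
      rw [this.fderiv_eq, fderiv_fun_sum fun i _ => (hgs i).differentiable one_ne_zero x]
      simp
    · intro i _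
      exact ((((hgs i).continuous_fderiv one_ne_zero).clm_apply
        continuous_const).integrable_of_hasCompactSupport
        ((hgc i).fderiv_apply (𝕜 := ℝ) e)).integrableOn
  have e2 : ∫ x, f x * ⟪e, outerNormal Ω x⟫ ∂(surfaceMeasure Ω) =
      ∑ i, ∫ x, g i x * ⟪e, outerNormal Ω x⟫ ∂(surfaceMeasure Ω) := by
    rw [← integral_finsetSum]
    · refine setIntegral_surfaceMeasure_congr fun x hx => ?_
      rw [hfsum x (frontier_subset_closure hx), Finset.sum_mul]
    · exact fun i _ => integrable_surfaceMeasure hd hΩ ((hgs i).continuous.continuousOn.mul hcont)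
  have e3 : ∫ x, f x ∂(surfaceMeasure Ω) = ∑ i, ∫ x, g i x ∂(surfaceMeasure Ω) := by
    rw [← integral_finsetSum]
    · exact setIntegral_surfaceMeasure_congr fun x hx => hfsum x (frontier_subset_closure hx)
    · exact fun i _ => integrable_surfaceMeasure hd hΩ (hgs i).continuous.continuousOn
  rw [e1, e2, e3, ← Finset.sum_sub_distrib, Finset.mul_sum]
  exact (Finset.abs_sum_le_sum_abs _ _).trans (Finset.sum_le_sum fun i _ => hgi i)

theorem integral_fderiv_eq_of_nonneg (hd : 1 ≤ d) (hΩ : IsSmoothBoundedDomain Ω) {f : Space d → ℝ}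
    (hf : ContDiff ℝ 1 f) (hf0 : ∀ x ∈ frontier Ω, 0 ≤ f x) (e : Space d) :
    ∫ x in Ω, fderiv ℝ f x e = ∫ x, f x * ⟪e, outerNormal Ω x⟫ ∂(surfaceMeasure Ω) := by
  have h : ∀ ε > 0,
      |(∫ x in Ω, fderiv ℝ f x e) - ∫ x, f x * ⟪e, outerNormal Ω x⟫ ∂(surfaceMeasure Ω)| ≤
        ε * ∫ x, f x ∂(surfaceMeasure Ω) := fun ε hε => abs_divergence_sub_le hd hΩ hf hf0 e hε
  have hlim : Tendsto (fun ε : ℝ => ε * ∫ x, f x ∂(surfaceMeasure Ω)) (𝓝[>] 0) (𝓝 0) := by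
    have : Continuous fun ε : ℝ => ε * ∫ x, f x ∂(surfaceMeasure Ω) := by fun_prop
    simpa using (this.tendsto 0).mono_left nhdsWithin_le_nhds
  have := ge_of_tendsto hlim (eventually_nhdsWithin_of_forall (s := Ioi 0) h)
  exact sub_eq_zero.1 (abs_eq_zero.1 (le_antisymm this (abs_nonneg _)))

/-- The divergence theorem on a bounded domain with smooth boundary, for the vector field `f e`
with a constant vector `e`. -/
theorem integral_fderiv_eq_surface_integral (hd : 1 ≤ d) (hΩ : IsSmoothBoundedDomain Ω)
    {f : Space d → ℝ} (hf : ContDiff ℝ 1 f) (e : Space d) :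
    ∫ x in Ω, fderiv ℝ f x e = ∫ x, f x * ⟪e, outerNormal Ω x⟫ ∂(surfaceMeasure Ω) := by
  -- Adding the constant |K| makes f nonnegative on the boundary; the constant's own identity is
  -- then subtracted.
  obtain ⟨K, hK⟩ := (isCompact_frontier hΩ).exists_bound_of_continuousOn hf.continuous.continuousOn
  have hcont : ContinuousOn (fun x => ⟪e, outerNormal Ω x⟫) (frontier Ω) :=
    continuousOn_const.inner (continuousOn_outerNormal hΩ)
  have h1 := integral_fderiv_eq_of_nonneg hd hΩ (f := fun x => f x + |K|) (hf.add contDiff_const)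
    (fun x hx => by
      have := (abs_le.1 ((hK x hx).trans (le_abs_self K))).1
      linarith) e
  have h2 := integral_fderiv_eq_of_nonneg hd hΩ (f := fun _ => |K|) contDiff_const
    (fun x _ => abs_nonneg K) e
  simp only [fderiv_add_const, add_mul] at h1
  have hi1 : Integrable (fun x => f x * ⟪e, outerNormal Ω x⟫) (surfaceMeasure Ω) :=
    integrable_surfaceMeasure hd hΩ (hf.continuous.continuousOn.mul hcont)
  have hi2 : Integrable (fun x => |K| * ⟪e, outerNormal Ω x⟫) (surfaceMeasure Ω) :=
    integrable_surfaceMeasure hd hΩ (continuousOn_const.mul hcont)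
  rw [integral_add hi1 hi2, ← h2] at h1
  simpa using h1

end Divergence

/-! ### Classical derivatives and the weight. -/

section Derivatives

variable {d : ℕ}

theorem hasDerivAt_timeSlice {f : Space d × ℝ → ℝ} {p : Space d × ℝ}
    (hf : DifferentiableAt ℝ f p) :
    HasDerivAt (fun r => f (p.1, r)) (fderiv ℝ f p (0, 1)) p.2 := by
  have h1 : HasDerivAt (fun r : ℝ => (p.1, r)) (0, 1) p.2 :=
    (hasDerivAt_const p.2 p.1).prodMk (hasDerivAt_id p.2)
  exact hf.hasFDerivAt.comp_hasDerivAt p.2 h1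

theorem hasFDerivAt_spaceSlice {f : Space d × ℝ → ℝ} {p : Space d × ℝ}
    (hf : DifferentiableAt ℝ f p) :
    HasFDerivAt (fun y => f (y, p.2))
      ((fderiv ℝ f p).comp (ContinuousLinearMap.inl ℝ (Space d) ℝ)) p.1 :=
  hf.hasFDerivAt.comp p.1 (hasFDerivAt_prodMk_left p.1 p.2)

theorem timeDeriv_eq {f : Space d × ℝ → ℝ} {p : Space d × ℝ} (hf : DifferentiableAt ℝ f p) :
    timeDeriv f p = fderiv ℝ f p (0, 1) :=
  (hasDerivAt_timeSlice hf).deriv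

theorem inner_spaceGrad_eq {f : Space d × ℝ → ℝ} {p : Space d × ℝ} (hf : DifferentiableAt ℝ f p)
    (h : Space d) : ⟪h, spaceGrad f p⟫ = fderiv ℝ f p (h, 0) := by
  rw [spaceGrad, inner_gradient_right, (hasFDerivAt_spaceSlice hf).fderiv]
  simp

theorem transport_eq {f : Space d × ℝ → ℝ} {p : Space d × ℝ} (hf : DifferentiableAt ℝ f p)
    (H : ℝ → Space d) :
    transport H (timeDeriv f) (spaceGrad f) p = fderiv ℝ f p (H p.2, 1) := by
  rw [transport, timeDeriv_eq hf, inner_spaceGrad_eq hf, ← map_add]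
  simp

theorem contDiff_weight (x₀ : Space d) (β : ℝ) : ContDiff ℝ ∞ (weight x₀ β) := by
  unfold weight
  exact ((contDiff_fst.sub contDiff_const).norm_sq ℝ).sub (contDiff_const.mul (contDiff_snd.pow 2))

theorem fderiv_weight (x₀ : Space d) (β : ℝ) (p q : Space d × ℝ) :
    fderiv ℝ (weight x₀ β) p q = 2 * ⟪q.1, p.1 - x₀⟫ - 2 * β * p.2 * q.2 := by
  have h1 : HasFDerivAt (fun p : Space d × ℝ => p.1 - x₀) (ContinuousLinearMap.fst ℝ (Space d) ℝ)
      p := hasFDerivAt_fst.sub_const x₀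
  have h2 := (h1.norm_sq).sub (((hasFDerivAt_snd (p := p)).pow 2).const_mul β)
  have h3 : HasFDerivAt (weight x₀ β) _ p := h2
  rw [h3.fderiv, real_inner_comm]
  simp [inner_sub_left]
  ring

theorem transportWeight_apply (H : ℝ → Space d) (x₀ : Space d) (β : ℝ) (p : Space d × ℝ) :
    transportWeight H x₀ β p = 2 * ⟪H p.2, p.1 - x₀⟫ - 2 * β * p.2 := by
  rw [transportWeight, transport_eq ((contDiff_weight x₀ β).differentiable (by simp) p),
    fderiv_weight]
  simp

end Derivatives

/-! ### Integration by parts on the space-time cylinder. -/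

section Cylinder

variable {d : ℕ} {Ω : Set (Space d)} {τ : ℝ}

theorem cylinderMeasure_eq (Ω : Set (Space d)) (τ : ℝ) :
    cylinderMeasure Ω τ = (volume.restrict Ω).prod (volume.restrict (Ioo (-τ) τ)) := by
  rw [cylinderMeasure, cylinder, Measure.volume_eq_prod, Measure.prod_restrict]

theorem lateralMeasure_eq (hd : 1 ≤ d) (hΩ : IsSmoothBoundedDomain Ω) (τ : ℝ) :
    lateralMeasure Ω τ =
      ((surfaceMeasure Ω).prod volume).restrict (frontier Ω ×ˢ Ioo (-τ) τ) := by
  have := isFiniteMeasure_surfaceMeasure hd hΩ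
  rw [lateralMeasure, ← Measure.prod_restrict]
  congr 1
  rw [surfaceMeasure, Measure.restrict_restrict isClosed_frontier.measurableSet, inter_self]

theorem integrable_cylinderMeasure (hΩ : IsSmoothBoundedDomain Ω) {f : Space d × ℝ → ℝ}
    (hf : ContinuousOn f (closure Ω ×ˢ Icc (-τ) τ)) : Integrable f (cylinderMeasure Ω τ) := by
  have hsub : cylinder Ω τ ⊆ closure Ω ×ˢ Icc (-τ) τ :=
    prod_mono subset_closure Ioo_subset_Icc_self
  have hK : IsCompact (closure Ω ×ˢ Icc (-τ) τ) := hΩ.2.2.1.isCompact_closure.prod isCompact_Icc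
  exact hf.integrableOn_of_subset_isCompact hK (hΩ.1.measurableSet.prod measurableSet_Ioo) hsub
    ((measure_mono hsub).trans_lt hK.measure_lt_top).ne

theorem integrable_lateralMeasure (hd : 1 ≤ d) (hΩ : IsSmoothBoundedDomain Ω)
    {f : Space d × ℝ → ℝ} (hf : ContinuousOn f (frontier Ω ×ˢ Icc (-τ) τ)) :
    Integrable f (lateralMeasure Ω τ) := by
  have := isFiniteMeasure_surfaceMeasure hd hΩ
  rw [lateralMeasure_eq hd hΩ]
  refine hf.integrableOn_of_subset_isCompact ((isCompact_frontier hΩ).prod isCompact_Icc)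
    (isClosed_frontier.measurableSet.prod measurableSet_Ioo)
    (prod_mono Subset.rfl Ioo_subset_Icc_self) ?_
  rw [Measure.prod_prod]
  exact ENNReal.mul_ne_top (measure_ne_top _ _) (by simp)

theorem integral_timeDeriv_cylinder (hΩ : IsSmoothBoundedDomain Ω) (hτ : 0 < τ)
    {F F' : Space d × ℝ → ℝ} (hF : ContinuousOn F (closure Ω ×ˢ Icc (-τ) τ))
    (hF' : ContinuousOn F' (closure Ω ×ˢ Icc (-τ) τ))
    (hder : ∀ x ∈ Ω, ∀ t ∈ Ioo (-τ) τ, HasDerivAt (fun r => F (x, r)) (F' (x, t)) t) :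
    ∫ p, F' p ∂(cylinderMeasure Ω τ) = ∫ x in Ω, (F (x, τ) - F (x, -τ)) := by
  have hi := integrable_cylinderMeasure hΩ hF'
  rw [cylinderMeasure_eq] at hi ⊢
  rw [integral_prod _ hi]
  refine setIntegral_congr_fun hΩ.1.measurableSet fun x hx => ?_
  have hslice : ContinuousOn (fun t : ℝ => (x, t)) (Icc (-τ) τ) := by fun_prop
  have hmaps : MapsTo (fun t : ℝ => (x, t)) (Icc (-τ) τ) (closure Ω ×ˢ Icc (-τ) τ) :=
    fun t ht => ⟨subset_closure hx, ht⟩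
  have hle : -τ ≤ τ := by linarith
  rw [← integral_Ioc_eq_integral_Ioo, ← intervalIntegral.integral_of_le hle]
  refine intervalIntegral.integral_eq_sub_of_hasDerivAt_of_le hle (hF.comp hslice hmaps)
    (hder x hx) ?_
  refine ContinuousOn.intervalIntegrable ?_
  rw [uIcc_of_le hle]
  exact hF'.comp hslice hmaps

/-- At a fixed time H(t) is a constant vector, so the divergence theorem applies slice by slice.
Keeping space and time apart means F need not be jointly smooth, as Aφ is not when H is merely C¹ on
a closed interval. -/
theorem integral_spaceDeriv_cylinder (hd : 1 ≤ d) (hΩ : IsSmoothBoundedDomain Ω)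
    {H : ℝ → Space d} (hH : ContinuousOn H (Icc (-τ) τ))
    {F F' : Space d × ℝ → ℝ} (hF : ContinuousOn F (closure Ω ×ˢ Icc (-τ) τ))
    (hF' : ContinuousOn F' (closure Ω ×ˢ Icc (-τ) τ))
    (hsm : ∀ t ∈ Ioo (-τ) τ, ContDiff ℝ 1 fun x => F (x, t))
    (hder : ∀ x ∈ Ω, ∀ t ∈ Ioo (-τ) τ, fderiv ℝ (fun y => F (y, t)) x (H t) = F' (x, t)) :
    ∫ p, F' p ∂(cylinderMeasure Ω τ) =
      ∫ p, F p * ⟪H p.2, outerNormal Ω p.1⟫ ∂(lateralMeasure Ω τ) := by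
  have := isFiniteMeasure_surfaceMeasure hd hΩ
  have hi := integrable_cylinderMeasure hΩ hF'
  have hil : Integrable (fun p => F p * ⟪H p.2, outerNormal Ω p.1⟫) (lateralMeasure Ω τ) := by
    refine integrable_lateralMeasure hd hΩ ?_
    refine (hF.mono (prod_mono frontier_subset_closure Subset.rfl)).mul ?_
    exact (hH.comp continuousOn_snd fun p hp => hp.2).inner
      ((continuousOn_outerNormal hΩ).comp continuousOn_fst fun p hp => hp.1)
  rw [cylinderMeasure_eq] at hi ⊢
  rw [lateralMeasure] at hil ⊢
  rw [integral_prod_symm _ hi, integral_prod_symm _ hil]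
  refine setIntegral_congr_fun measurableSet_Ioo fun t ht => ?_
  dsimp only
  rw [← integral_fderiv_eq_surface_integral hd hΩ (hsm t ht) (H t)]
  exact setIntegral_congr_fun hΩ.1.measurableSet fun x hx => (hder x hx t ht).symm

end Cylinder

/-! ### Passing to the limit in weighted quadratic integrals. -/

section Limit

/-- Factor v² - g² = (v - g)(v + g), apply Hölder, and write v + g = (v - g) + 2g to bound the
second factor. W may change sign, as the lateral coefficient does. -/
theorem tendsto_integral_mul_sq {X : Type*} [MeasurableSpace X] {μ : Measure X}
    {W g : X → ℝ} {v : ℕ → X → ℝ} {M : ℝ} (hW : AEStronglyMeasurable W μ)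
    (hM : ∀ᵐ x ∂μ, ‖W x‖ ≤ M) (hg : MemLp g 2 μ) (hv : ∀ n, AEStronglyMeasurable (v n) μ)
    (hlim : Tendsto (fun n => eLpNorm (v n - g) 2 μ) atTop (𝓝 0)) :
    Integrable (fun x => W x * |g x| ^ 2) μ ∧
    Tendsto (fun n => ∫ x, W x * |v n x| ^ 2 ∂μ) atTop (𝓝 (∫ x, W x * |g x| ^ 2 ∂μ)) := by
  have hint : ∀ f, MemLp f 2 μ → Integrable (fun x => W x * |f x| ^ 2) μ := by
    intro f hf
    simp only [sq_abs]
    exact hf.integrable_sq.bdd_mul hW hM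
  refine ⟨hint g hg, tendsto_integral_of_L1' _ (hint g hg).1 ?_ ?_⟩
  · filter_upwards [hlim.eventually_lt_const ENNReal.zero_lt_top] with n hn
    refine hint _ ?_
    have : MemLp (v n - g) 2 μ := ⟨(hv n).sub hg.1, hn⟩
    simpa using this.add hg
  · have hb : ∀ n, eLpNorm ((fun x => W x * |v n x| ^ 2) - fun x => W x * |g x| ^ 2) 1 μ ≤
        ENNReal.ofReal M * (eLpNorm (v n - g) 2 μ *
          (eLpNorm (v n - g) 2 μ + 2 * eLpNorm g 2 μ)) := by
      intro n
      have h1 : eLpNorm ((fun x => W x * |v n x| ^ 2) - fun x => W x * |g x| ^ 2) 1 μ ≤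
          ENNReal.ofReal M * eLpNorm ((v n - g) • (v n + g)) 1 μ := by
        refine eLpNorm_le_mul_eLpNorm_of_ae_le_mul ?_ 1
        filter_upwards [hM] with x hx
        simp only [Pi.sub_apply, Pi.smul_apply', Pi.add_apply, sq_abs, smul_eq_mul]
        rw [show W x * v n x ^ 2 - W x * g x ^ 2 = W x * ((v n x - g x) * (v n x + g x)) by ring,
          norm_mul]
        exact mul_le_mul_of_nonneg_right hx (norm_nonneg _)
      refine h1.trans ?_
      gcongr
      refine (eLpNorm_smul_le_mul_eLpNorm (p := 2) (q := 2) (r := 1)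
        ((hv n).add hg.1) ((hv n).sub hg.1)).trans ?_
      gcongr
      have h2 : v n + g = (v n - g) + (g + g) := by abel
      rw [h2, two_mul]
      refine (eLpNorm_add_le ((hv n).sub hg.1) (hg.1.add hg.1) one_le_two).trans ?_
      gcongr
      exact eLpNorm_add_le hg.1 hg.1 one_le_two
    refine tendsto_of_tendsto_of_tendsto_of_le_of_le tendsto_const_nhds ?_ (fun _ => zero_le) hb
    have hfin : 2 * eLpNorm g 2 μ ≠ ⊤ := ENNReal.mul_ne_top (by simp) hg.2.ne
    have h3 := ENNReal.Tendsto.mul hlim (Or.inr (by simpa using hfin))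
      (hlim.add_const (2 * eLpNorm g 2 μ)) (Or.inr (by simp))
    have h4 := ENNReal.Tendsto.const_mul (a := ENNReal.ofReal M) h3 (Or.inr (by simp))
    simpa using h4

end Limit

/-! ### The Carleman inequality for smooth functions. -/

section Carleman

variable {d : ℕ} {Ω : Set (Space d)} {τ : ℝ} {H : ℝ → Space d}

theorem continuousOn_transportWeight (hH : ContinuousOn H (Icc (-τ) τ)) (x₀ : Space d) (β : ℝ)
    (S : Set (Space d)) : ContinuousOn (transportWeight H x₀ β) (S ×ˢ Icc (-τ) τ) := by
  have h : ContinuousOn (fun p : Space d × ℝ => H p.2) (S ×ˢ Icc (-τ) τ) :=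
    hH.comp continuousOn_snd fun p hp => hp.2
  have h1 : ContinuousOn (fun p : Space d × ℝ => ⟪H p.2, p.1 - x₀⟫) (S ×ˢ Icc (-τ) τ) :=
    h.inner (by fun_prop)
  have h2 : transportWeight H x₀ β = fun p => 2 * ⟪H p.2, p.1 - x₀⟫ - 2 * β * p.2 :=
    funext (transportWeight_apply H x₀ β)
  rw [h2]
  fun_prop

theorem fderiv_exp_weight_mul_sq {v : Space d × ℝ → ℝ} (hv : ContDiff ℝ ∞ v) (x₀ : Space d)
    (β s : ℝ) (p q : Space d × ℝ) :
    fderiv ℝ (fun p => Real.exp (2 * s * weight x₀ β p) * v p ^ 2) p q =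
      Real.exp (2 * s * weight x₀ β p) *
        (2 * s * fderiv ℝ (weight x₀ β) p q * v p ^ 2 + 2 * v p * fderiv ℝ v p q) := by
  have h1 : HasFDerivAt v (fderiv ℝ v p) p := (hv.differentiable (by simp) p).hasFDerivAt
  have h2 : HasFDerivAt (weight x₀ β) (fderiv ℝ (weight x₀ β) p) p :=
    ((contDiff_weight x₀ β).differentiable (by simp) p).hasFDerivAt
  have h3 := ((h2.const_mul (2 * s)).exp).mul (h1.pow 2)
  have h4 : HasFDerivAt (fun p => Real.exp (2 * s * weight x₀ β p) * v p ^ 2) _ p := h3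
  rw [h4.fderiv]
  simp
  ring

/-- The Carleman inequality for functions which are smooth up to the boundary. -/
theorem carleman_of_contDiff (hd : 1 ≤ d) (hΩ : IsSmoothBoundedDomain Ω) (hτ : 0 < τ)
    (hH : ContDiffOn ℝ 1 H (Icc (-τ) τ)) (x₀ : Space d) {β κ s : ℝ} (hs : 0 < s)
    (hκ : ∀ x ∈ Ω, ∀ t ∈ Ioo (-τ) τ,
      κ ≤ 2 * ⟪derivWithin H (Icc (-τ) τ) t, x - x₀⟫ - 2 * β)
    {v : Space d × ℝ → ℝ} (hv : ContDiff ℝ ∞ v) :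
    κ * s * ∫ p, Real.exp (2 * s * weight x₀ β p) * |v p| ^ 2 ∂(cylinderMeasure Ω τ) ≤
      ∫ p, Real.exp (2 * s * weight x₀ β p) *
          |transport H (timeDeriv v) (spaceGrad v) p| ^ 2 ∂(cylinderMeasure Ω τ)
      + s * ∫ p, Real.exp (2 * s * weight x₀ β p) * transportWeight H x₀ β p *
          ⟪H p.2, outerNormal Ω p.1⟫ * |v p| ^ 2 ∂(lateralMeasure Ω τ)
      + s * ∫ x in Ω,
          (transportWeight H x₀ β (x, τ) *
              (Real.exp (2 * s * weight x₀ β (x, τ)) * |v (x, τ)| ^ 2) -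
            transportWeight H x₀ β (x, -τ) *
              (Real.exp (2 * s * weight x₀ β (x, -τ)) * |v (x, -τ)| ^ 2)) := by
  simp only [sq_abs]
  set K : Set (Space d × ℝ) := closure Ω ×ˢ Icc (-τ) τ with hK
  set a := transportWeight H x₀ β with ha
  set w : Space d × ℝ → ℝ := fun p => Real.exp (2 * s * weight x₀ β p) * v p ^ 2 with hw
  have hwsm : ContDiff ℝ ∞ w :=
    ((contDiff_const.mul (contDiff_weight x₀ β)).exp).mul (hv.pow 2)
  have hvd : Differentiable ℝ v := hv.differentiable (by simp)
  have hwd : Differentiable ℝ w := hwsm.differentiable (by simp)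
  have hHc : ContinuousOn (fun p : Space d × ℝ => H p.2) K :=
    hH.continuousOn.comp continuousOn_snd fun p hp => hp.2
  have hH'c : ContinuousOn (fun p : Space d × ℝ => derivWithin H (Icc (-τ) τ) p.2) K :=
    (hH.continuousOn_derivWithin (uniqueDiffOn_Icc (by linarith)) le_rfl).comp continuousOn_snd fun p hp => hp.2
  have hac : ContinuousOn a K := continuousOn_transportWeight hH.continuousOn x₀ β _
  have hwc : ContinuousOn w K := hwsm.continuous.continuousOn
  have hdw : Continuous (fderiv ℝ w) := hwsm.continuous_fderiv (by simp)
  have hdv : Continuous (fderiv ℝ v) := hv.continuous_fderiv (by simp)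
  -- `Ft` and `Fx` are the time and space parts of A(aw); their sum contains Aa times w.
  set Ft : Space d × ℝ → ℝ := fun p =>
    (2 * ⟪derivWithin H (Icc (-τ) τ) p.2, p.1 - x₀⟫ - 2 * β) * w p + a p * fderiv ℝ w p (0, 1)
    with hFt
  set Fx : Space d × ℝ → ℝ := fun p => 2 * ‖H p.2‖ ^ 2 * w p + a p * fderiv ℝ w p (H p.2, 0)
    with hFx
  have hFc : ContinuousOn (fun p => a p * w p) K := hac.mul hwc
  have hFtc : ContinuousOn Ft K :=
    (((continuousOn_const.mul (hH'c.inner (continuousOn_fst.sub continuousOn_const))).sub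
      continuousOn_const).mul hwc).add
      (hac.mul (hdw.continuousOn.clm_apply continuousOn_const))
  have hFxc : ContinuousOn Fx K :=
    ((continuousOn_const.mul (hHc.norm.pow 2)).mul hwc).add
      (hac.mul (hdw.continuousOn.clm_apply (hHc.prodMk continuousOn_const)))
  have hT := integral_timeDeriv_cylinder hΩ hτ hFc hFtc (by
    intro x _ t ht
    have hH' : HasDerivAt H (derivWithin H (Icc (-τ) τ) t) t :=
      ((hH.differentiableOn one_ne_zero t (Ioo_subset_Icc_self ht)).hasDerivWithinAt).hasDerivAt
        (Icc_mem_nhds ht.1 ht.2)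
    have h1 : HasDerivAt (fun r => a (x, r))
        (2 * ⟪derivWithin H (Icc (-τ) τ) t, x - x₀⟫ - 2 * β) t := by
      simp only [ha, transportWeight_apply]
      have h2 : HasDerivAt (fun r => ⟪H r, x - x₀⟫)
          ⟪derivWithin H (Icc (-τ) τ) t, x - x₀⟫ t := by
        simpa using hH'.inner ℝ (hasDerivAt_const t (x - x₀))
      have h3 : HasDerivAt (fun r : ℝ => 2 * β * r) (2 * β) t := by
        simpa using (hasDerivAt_id t).const_mul (2 * β)
      exact (h2.const_mul 2).sub h3
    exact h1.mul (hasDerivAt_timeSlice (p := (x, t)) (hwd _)))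
  have hasm : ∀ t, ContDiff ℝ 1 fun x : Space d => a (x, t) := by
    intro t
    simp only [ha, transportWeight_apply]
    exact (contDiff_const.mul (contDiff_const.inner ℝ (contDiff_id.sub contDiff_const))).sub
      contDiff_const
  have hS := integral_spaceDeriv_cylinder hd hΩ hH.continuousOn hFc hFxc
    (fun t _ => (hasm t).mul ((hwsm.of_le (by simp)).comp (contDiff_id.prodMk contDiff_const))) (by
    intro x _ t _
    have h1 : HasFDerivAt (fun y : Space d => a (y, t)) ((2 : ℝ) • innerSL ℝ (H t)) x := by
      simp only [ha, transportWeight_apply]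
      exact ((((innerSL ℝ (H t)).hasFDerivAt).comp x ((hasFDerivAt_id x).sub_const x₀)).const_mul
        2).sub_const _
    have h2 : HasFDerivAt (fun y : Space d => a (y, t) * w (y, t)) _ x :=
      h1.mul (hasFDerivAt_spaceSlice (p := (x, t)) (hwd _))
    rw [h2.fderiv]
    simp [hFx]
    ring)
  have hAc : ContinuousOn (fun p => Real.exp (2 * s * weight x₀ β p) *
      transport H (timeDeriv v) (spaceGrad v) p ^ 2) K := by
    simp only [fun p => transport_eq (hvd p) H]
    exact ((continuous_const.mul (contDiff_weight x₀ β).continuous).rexp.continuousOn).mul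
      ((hdv.continuousOn.clm_apply (hHc.prodMk continuousOn_const)).pow 2)
  have hmain : κ * s * ∫ p, w p ∂(cylinderMeasure Ω τ) ≤
      ∫ p, (Real.exp (2 * s * weight x₀ β p) * transport H (timeDeriv v) (spaceGrad v) p ^ 2 +
        s * (Ft p + Fx p)) ∂(cylinderMeasure Ω τ) := by
    rw [← integral_const_mul]
    refine setIntegral_mono_on (integrable_cylinderMeasure hΩ (continuousOn_const.mul hwc))
      (integrable_cylinderMeasure hΩ (hAc.add (continuousOn_const.mul (hFtc.add hFxc))))
      (hΩ.1.measurableSet.prod measurableSet_Ioo) fun p hp => ?_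
    have hk := hκ p.1 hp.1 p.2 hp.2
    have h1 : fderiv ℝ w p (0, 1) + fderiv ℝ w p (H p.2, 0) =
        Real.exp (2 * s * weight x₀ β p) *
          (2 * s * a p * v p ^ 2 + 2 * v p * transport H (timeDeriv v) (spaceGrad v) p) := by
      have ht : a p = fderiv ℝ (weight x₀ β) p (H p.2, 1) :=
        transport_eq ((contDiff_weight x₀ β).differentiable (by simp) p) H
      rw [transport_eq (hvd p) H, ht, ← fderiv_exp_weight_mul_sq hv, ← map_add]
      simp [hw]
    have hE : 0 < Real.exp (2 * s * weight x₀ β p) := Real.exp_pos _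
    have h2 : Ft p + Fx p = (2 * ⟪derivWithin H (Icc (-τ) τ) p.2, p.1 - x₀⟫ - 2 * β) * w p +
        2 * ‖H p.2‖ ^ 2 * w p +
        a p * (fderiv ℝ w p (0, 1) + fderiv ℝ w p (H p.2, 0)) := by
      simp only [hFt, hFx]; ring
    rw [h2, h1]
    have hwp : 0 ≤ w p := mul_nonneg hE.le (sq_nonneg _)
    set A := transport H (timeDeriv v) (spaceGrad v) p
    set E := Real.exp (2 * s * weight x₀ β p) with hEdef
    have hwE : w p = E * v p ^ 2 := rfl
    -- These two squares account for e^{2sφ}|Av|² + s a Aw exactly; what remains is s (Aa) w.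
    have h3 : 0 ≤ E * (A + s * a p * v p) ^ 2 := mul_nonneg hE.le (sq_nonneg _)
    have h4 : 0 ≤ E * (s * a p * v p) ^ 2 := mul_nonneg hE.le (sq_nonneg _)
    have h5 : κ * s * w p ≤
        s * ((2 * ⟪derivWithin H (Icc (-τ) τ) p.2, p.1 - x₀⟫ - 2 * β) * w p) := by
      have := mul_le_mul_of_nonneg_right hk (mul_nonneg hs.le hwp)
      nlinarith
    have h6 : 0 ≤ s * (2 * ‖H p.2‖ ^ 2 * w p) := by positivity
    nlinarith
  have hFi : Integrable (fun p => Ft p + Fx p) (cylinderMeasure Ω τ) :=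
    integrable_cylinderMeasure hΩ (hFtc.add hFxc)
  rw [integral_add (integrable_cylinderMeasure hΩ hAc) (hFi.const_mul s), integral_const_mul,
    integral_add (integrable_cylinderMeasure hΩ hFtc) (integrable_cylinderMeasure hΩ hFxc),
    hT, hS] at hmain
  refine hmain.trans (le_of_eq ?_)
  have hl : ∫ p, a p * w p * ⟪H p.2, outerNormal Ω p.1⟫ ∂(lateralMeasure Ω τ) =
      ∫ p, Real.exp (2 * s * weight x₀ β p) * a p * ⟪H p.2, outerNormal Ω p.1⟫ * v p ^ 2
        ∂(lateralMeasure Ω τ) :=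
    integral_congr_ae (Eventually.of_forall fun p => by simp only [hw]; ring)
  rw [← hl]
  ring

end Carleman

/-! ### Existence of admissible points. -/

section AdmissiblePoint

variable {E : Type*} [NormedAddCommGroup E] [InnerProductSpace ℝ E]

/-- If `p` and `q` make an angle of cosine at least `c` with `θ`, then they make an angle of cosine
at least `2 c² - 1` with each other. -/
theorem le_inner_of_le_inner {p q θ : E} (hθ : ‖θ‖ = 1) {c : ℝ} (hc : 0 ≤ c)
    (hp : c * ‖p‖ ≤ ⟪p, θ⟫) (hq : c * ‖q‖ ≤ ⟪q, θ⟫) :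
    (2 * c ^ 2 - 1) * (‖p‖ * ‖q‖) ≤ ⟪p, q⟫ := by
  have hθθ : ⟪θ, θ⟫ = 1 := by rw [real_inner_self_eq_norm_sq, hθ, one_pow]
  have hnorm : ∀ x : E, ‖x - ⟪x, θ⟫ • θ‖ ^ 2 = ‖x‖ ^ 2 - ⟪x, θ⟫ ^ 2 := by
    intro x
    rw [norm_sub_sq_real, inner_smul_right, norm_smul, hθ, mul_one, Real.norm_eq_abs, sq_abs]
    ring
  -- The parts along θ contribute at least c²‖p‖‖q‖, the orthogonal parts at least -(1 - c²)‖p‖‖q‖.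
  have hinner : ⟪p, q⟫ = ⟪p, θ⟫ * ⟪q, θ⟫ + ⟪p - ⟪p, θ⟫ • θ, q - ⟪q, θ⟫ • θ⟫ := by
    simp only [inner_sub_left, inner_sub_right, inner_smul_left, inner_smul_right, hθθ,
      real_inner_comm θ q]
    simp
  have hle : ∀ x : E, c * ‖x‖ ≤ ⟪x, θ⟫ → ‖x - ⟪x, θ⟫ • θ‖ ^ 2 ≤ (1 - c ^ 2) * ‖x‖ ^ 2 := by
    intro x hx
    rw [hnorm]
    have := pow_le_pow_left₀ (mul_nonneg hc (norm_nonneg x)) hx 2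
    nlinarith
  have h1 := abs_real_inner_le_norm (p - ⟪p, θ⟫ • θ) (q - ⟪q, θ⟫ • θ)
  set P := ‖p - ⟪p, θ⟫ • θ‖
  set Q := ‖q - ⟪q, θ⟫ • θ‖
  have hP := hle p hp
  have hQ := hle q hq
  have h3 : c * ‖p‖ * (c * ‖q‖) ≤ ⟪p, θ⟫ * ⟪q, θ⟫ :=
    mul_le_mul hp hq (by positivity) ((mul_nonneg hc (norm_nonneg p)).trans hp)
  have h4 : P * Q ≤ (1 - c ^ 2) * (‖p‖ * ‖q‖) := by
    rcases (norm_nonneg p).eq_or_lt with hp0 | hp0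
    · have : P = 0 := by
        have : P ^ 2 ≤ 0 := hP.trans_eq (by rw [← hp0]; ring)
        exact pow_eq_zero_iff two_ne_zero |>.1 (le_antisymm this (sq_nonneg _))
      simp [this, ← hp0]
    -- The bound c ≤ 1 is not assumed; it is forced by p ≠ 0.
    · have hc1 : 0 ≤ 1 - c ^ 2 := by
        by_contra hneg
        have := mul_neg_of_neg_of_pos (not_le.1 hneg) (pow_pos hp0 2)
        nlinarith [sq_nonneg P]
      refine abs_le_of_sq_le_sq' ?_ (by positivity) |>.2
      rw [mul_pow]
      calc P ^ 2 * Q ^ 2 ≤ ((1 - c ^ 2) * ‖p‖ ^ 2) * ((1 - c ^ 2) * ‖q‖ ^ 2) := by gcongr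
        _ = ((1 - c ^ 2) * (‖p‖ * ‖q‖)) ^ 2 := by ring
  have h5 := (abs_le.1 h1).1
  rw [hinner]
  nlinarith

theorem exists_isAdmissiblePoint {d : ℕ} {Ω : Set (Space d)} (hΩ : Bornology.IsBounded Ω)
    {τ c₀ : ℝ} (hc₀ : 0 < c₀) (hc₀' : c₀ < 1) {H : ℝ → Space d} {ρ : ℝ} (hρ : 0 < ρ)
    (hHρ : ∀ t ∈ Icc (-τ) τ, ρ ≤ ‖derivWithin H (Icc (-τ) τ) t‖)
    {θ₀ : Space d} (hθ₀ : ‖θ₀‖ = 1)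
    (hHθ : ∀ t ∈ Icc (-τ) τ,
      c₀ ≤ ⟪derivWithin H (Icc (-τ) τ) t, θ₀⟫ / ‖derivWithin H (Icc (-τ) τ) t‖) :
    ∃ x₀ : Space d, IsAdmissiblePoint Ω τ c₀ H x₀ := by
  obtain ⟨r, hr, hsub⟩ := hΩ.closure.exists_pos_norm_le
  -- R solves c₀(r + R) = R - r. With x₀ = -Rθ₀, the norm of x - x₀ is at most R + r and its
  -- component along θ₀ at least R - r.
  set R := r * (1 + c₀) / (1 - c₀) with hR
  have hc : 0 < 1 - c₀ := by linarith
  have hRr : R * (1 - c₀) = r * (1 + c₀) := by rw [hR]; field_simp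
  have hrR : r < R := by
    rw [hR, lt_div_iff₀ hc]; nlinarith
  have hnot : -(R • θ₀) ∉ closure Ω := by
    intro h
    have := hsub _ h
    rw [norm_neg, norm_smul, hθ₀, mul_one, Real.norm_eq_abs] at this
    linarith [le_abs_self R]
  refine ⟨-(R • θ₀), hnot, fun x hx t ht => ?_⟩
  have hH0 : 0 < ‖derivWithin H (Icc (-τ) τ) t‖ := hρ.trans_le (hHρ t ht)
  have hx0 : 0 < ‖x - -(R • θ₀)‖ := norm_pos_iff.2 (sub_ne_zero.2 fun h => hnot (h ▸ hx))
  rw [le_div_iff₀ (mul_pos hH0 hx0)]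
  refine le_inner_of_le_inner hθ₀ hc₀.le ((le_div_iff₀ hH0).1 (hHθ t ht)) ?_
  rw [sub_neg_eq_add, inner_add_left, inner_smul_left, real_inner_self_eq_norm_sq, hθ₀]
  have h1 : ‖x + R • θ₀‖ ≤ r + R := by
    refine (norm_add_le _ _).trans ?_
    rw [norm_smul, hθ₀, mul_one, Real.norm_eq_abs, abs_of_pos (hr.trans hrR)]
    linarith [hsub x hx]
  have h2 : -r ≤ ⟪x, θ₀⟫ := by
    have := (abs_le.1 (abs_real_inner_le_norm x θ₀)).1
    rw [hθ₀, mul_one] at this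
    linarith [hsub x hx]
  simp only [conj_trivial, one_pow, mul_one]
  nlinarith

end AdmissiblePoint

/-! ### From smooth functions to H¹ functions with traces. -/

section Trace

variable {d : ℕ} {Ω : Set (Space d)} {τ : ℝ} {H : ℝ → Space d}

theorem ae_mem_cylinder (hΩ : IsSmoothBoundedDomain Ω) :
    ∀ᵐ p ∂(cylinderMeasure Ω τ), p ∈ cylinder Ω τ :=
  ae_restrict_mem (hΩ.1.measurableSet.prod measurableSet_Ioo)

theorem ae_mem_lateral (hd : 1 ≤ d) (hΩ : IsSmoothBoundedDomain Ω) :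
    ∀ᵐ p ∂(lateralMeasure Ω τ), p ∈ frontier Ω ×ˢ Ioo (-τ) τ := by
  rw [lateralMeasure_eq hd hΩ]
  exact ae_restrict_mem (isClosed_frontier.measurableSet.prod measurableSet_Ioo)

theorem aestronglyMeasurable_coefficient (hΩ : IsSmoothBoundedDomain Ω)
    (hH : ContinuousOn H (Icc (-τ) τ)) :
    AEStronglyMeasurable (fun p : Space d × ℝ => H p.2) (cylinderMeasure Ω τ) := by
  have h : ContinuousOn (fun p : Space d × ℝ => H p.2) (cylinder Ω τ) :=
    hH.comp continuousOn_snd fun p hp => Ioo_subset_Icc_self hp.2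
  exact h.aestronglyMeasurable (hΩ.1.measurableSet.prod measurableSet_Ioo)

theorem exists_bound_coefficient (hΩ : IsSmoothBoundedDomain Ω)
    (hH : ContinuousOn H (Icc (-τ) τ)) :
    ∃ M, ∀ᵐ p ∂(cylinderMeasure Ω τ), ‖H p.2‖ ≤ M := by
  obtain ⟨M, hM⟩ := isCompact_Icc.exists_bound_of_continuousOn hH
  refine ⟨M, ?_⟩
  filter_upwards [ae_mem_cylinder hΩ] with p hp using hM _ (Ioo_subset_Icc_self hp.2)

theorem eLpNorm_inner_coefficient_le {M : ℝ}
    (hM : ∀ᵐ p ∂(cylinderMeasure Ω τ), ‖H p.2‖ ≤ M) (k : Space d × ℝ → Space d) :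
    eLpNorm (fun p => ⟪H p.2, k p⟫) 2 (cylinderMeasure Ω τ) ≤
      ENNReal.ofReal M * eLpNorm k 2 (cylinderMeasure Ω τ) := by
  refine eLpNorm_le_mul_eLpNorm_of_ae_le_mul ?_ 2
  filter_upwards [hM] with p hp
  exact (norm_inner_le_norm _ _).trans (mul_le_mul_of_nonneg_right hp (norm_nonneg _))

theorem memLp_transport (hΩ : IsSmoothBoundedDomain Ω) (hH : ContinuousOn H (Icc (-τ) τ))
    {ut : Space d × ℝ → ℝ} {gu : Space d × ℝ → Space d}
    (ht : MemLp ut 2 (cylinderMeasure Ω τ)) (hg : MemLp gu 2 (cylinderMeasure Ω τ)) :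
    MemLp (transport H ut gu) 2 (cylinderMeasure Ω τ) := by
  obtain ⟨M, hM⟩ := exists_bound_coefficient hΩ hH
  have h : MemLp (fun p => ⟪H p.2, gu p⟫) 2 (cylinderMeasure Ω τ) :=
    ⟨(aestronglyMeasurable_coefficient hΩ hH).inner hg.1,
      (eLpNorm_inner_coefficient_le hM gu).trans_lt (ENNReal.mul_lt_top (by simp) hg.2)⟩
  exact ht.add h

theorem tendsto_eLpNorm_transport (hΩ : IsSmoothBoundedDomain Ω)
    (hH : ContinuousOn H (Icc (-τ) τ)) {ut : Space d × ℝ → ℝ} {gu : Space d × ℝ → Space d}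
    {vt : ℕ → Space d × ℝ → ℝ} {gv : ℕ → Space d × ℝ → Space d}
    (hut : AEStronglyMeasurable ut (cylinderMeasure Ω τ))
    (hgu : AEStronglyMeasurable gu (cylinderMeasure Ω τ))
    (hvt : ∀ n, AEStronglyMeasurable (vt n) (cylinderMeasure Ω τ))
    (hgv : ∀ n, AEStronglyMeasurable (gv n) (cylinderMeasure Ω τ))
    (ht : Tendsto (fun n => eLpNorm (vt n - ut) 2 (cylinderMeasure Ω τ)) atTop (𝓝 0))
    (hg : Tendsto (fun n => eLpNorm (gv n - gu) 2 (cylinderMeasure Ω τ)) atTop (𝓝 0)) :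
    Tendsto (fun n => eLpNorm (transport H (vt n) (gv n) - transport H ut gu) 2
      (cylinderMeasure Ω τ)) atTop (𝓝 0) := by
  obtain ⟨M, hM⟩ := exists_bound_coefficient hΩ hH
  have hb : ∀ n, eLpNorm (transport H (vt n) (gv n) - transport H ut gu) 2 (cylinderMeasure Ω τ) ≤
      eLpNorm (vt n - ut) 2 (cylinderMeasure Ω τ) +
        ENNReal.ofReal M * eLpNorm (gv n - gu) 2 (cylinderMeasure Ω τ) := by
    intro n
    have h : transport H (vt n) (gv n) - transport H ut gu =
        (vt n - ut) + fun p => ⟪H p.2, (gv n - gu) p⟫ := by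
      ext p
      simp only [transport, Pi.sub_apply, Pi.add_apply, inner_sub_right]
      ring
    rw [h]
    refine (eLpNorm_add_le ((hvt n).sub hut)
      ((aestronglyMeasurable_coefficient hΩ hH).inner ((hgv n).sub hgu)) one_le_two).trans ?_
    gcongr
    exact eLpNorm_inner_coefficient_le hM _
  refine tendsto_of_tendsto_of_tendsto_of_le_of_le tendsto_const_nhds ?_ (fun _ => zero_le) hb
  simpa using ht.add (ENNReal.Tendsto.const_mul hg (Or.inr ENNReal.ofReal_ne_top))

theorem continuous_timeDeriv {v : Space d × ℝ → ℝ} (hv : ContDiff ℝ ∞ v) :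
    Continuous (timeDeriv v) := by
  have h : timeDeriv v = fun p => fderiv ℝ v p (0, 1) :=
    funext fun p => timeDeriv_eq (hv.differentiable (by simp) p)
  rw [h]
  exact (hv.continuous_fderiv (by simp)).clm_apply continuous_const

theorem continuous_spaceGrad {v : Space d × ℝ → ℝ} (hv : ContDiff ℝ ∞ v) :
    Continuous (spaceGrad v) := by
  have h : spaceGrad v = fun p => (InnerProductSpace.toDual ℝ (Space d)).symm
      ((fderiv ℝ v p).comp (ContinuousLinearMap.inl ℝ (Space d) ℝ)) := by
    ext1 p
    rw [spaceGrad, gradient, (hasFDerivAt_spaceSlice (hv.differentiable (by simp) p)).fderiv]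
  rw [h]
  exact (LinearIsometryEquiv.continuous _).comp
    ((hv.continuous_fderiv (by simp)).clm_comp continuous_const)

theorem exists_bound_transportWeight (hΩ : IsSmoothBoundedDomain Ω)
    (hH : ContinuousOn H (Icc (-τ) τ)) (x₀ : Space d) (β : ℝ) :
    ∃ M, 0 < M ∧ ∀ x ∈ Ω, ∀ t ∈ Icc (-τ) τ, |transportWeight H x₀ β (x, t)| ≤ M := by
  obtain ⟨M, hM⟩ := (hΩ.2.2.1.isCompact_closure.prod
    (isCompact_Icc (a := -τ) (b := τ))).exists_bound_of_continuousOn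
      (continuousOn_transportWeight hH x₀ β (closure Ω))
  -- The maximum with 1 keeps the constant C' positive.
  exact ⟨max M 1, lt_max_of_lt_right one_pos,
    fun x hx t ht => (hM (x, t) ⟨subset_closure hx, ht⟩).trans (le_max_left _ _)⟩

/-- The Carleman inequality for functions which are smooth up to the boundary, with the boundary
terms at the initial and final times estimated. -/
theorem carleman_of_contDiff_of_bound (hd : 1 ≤ d) (hΩ : IsSmoothBoundedDomain Ω) (hτ : 0 < τ)
    (hH : ContDiffOn ℝ 1 H (Icc (-τ) τ)) (x₀ : Space d) {β κ s M : ℝ} (hs : 0 < s) (hκ0 : 0 < κ)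
    (hκ : ∀ x ∈ Ω, ∀ t ∈ Ioo (-τ) τ,
      κ ≤ 2 * ⟪derivWithin H (Icc (-τ) τ) t, x - x₀⟫ - 2 * β)
    (hM : ∀ x ∈ Ω, ∀ t ∈ Icc (-τ) τ, |transportWeight H x₀ β (x, t)| ≤ M)
    {v : Space d × ℝ → ℝ} (hv : ContDiff ℝ ∞ v) :
    s * ∫ p, Real.exp (2 * s * weight x₀ β p) * |v p| ^ 2 ∂(cylinderMeasure Ω τ) ≤
      κ⁻¹ * ∫ p, Real.exp (2 * s * weight x₀ β p) *
          |transport H (timeDeriv v) (spaceGrad v) p| ^ 2 ∂(cylinderMeasure Ω τ)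
      + κ⁻¹ * s * ∫ p, Real.exp (2 * s * weight x₀ β p) * transportWeight H x₀ β p *
          ⟪H p.2, outerNormal Ω p.1⟫ * |v p| ^ 2 ∂(lateralMeasure Ω τ)
      + κ⁻¹ * M * s * ∫ x in Ω, (Real.exp (2 * s * weight x₀ β (x, τ)) * |v (x, τ)| ^ 2
          + Real.exp (2 * s * weight x₀ β (x, -τ)) * |v (x, -τ)| ^ 2) := by
  have h := carleman_of_contDiff hd hΩ hτ hH x₀ hs hκ hv
  have hwc : Continuous fun p => Real.exp (2 * s * weight x₀ β p) * |v p| ^ 2 :=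
    ((continuous_const.mul (contDiff_weight x₀ β).continuous).rexp).mul (hv.continuous.abs.pow 2)
  have hslice : ∀ t : ℝ, Continuous fun x : Space d => (x, t) := fun t => by fun_prop
  have hK := hΩ.2.2.1.isCompact_closure
  have hon : ∀ f : Space d → ℝ, ContinuousOn f (closure Ω) → IntegrableOn f Ω := fun f hf =>
    (hf.integrableOn_compact hK).mono_set subset_closure
  have hmem : τ ∈ Icc (-τ) τ := ⟨by linarith, le_rfl⟩
  have hmem' : -τ ∈ Icc (-τ) τ := ⟨le_rfl, by linarith⟩
  have hw : ∀ t, ContinuousOn (fun x => Real.exp (2 * s * weight x₀ β (x, t)) * |v (x, t)| ^ 2)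
      (closure Ω) := fun t => (hwc.comp (hslice t)).continuousOn
  have ha : ∀ t ∈ Icc (-τ) τ, ContinuousOn (fun x => transportWeight H x₀ β (x, t)) (closure Ω) :=
    fun t ht => (continuousOn_transportWeight hH.continuousOn x₀ β (closure Ω)).comp
      (hslice t).continuousOn fun x hx => ⟨hx, ht⟩
  have hend : ∫ x in Ω, (transportWeight H x₀ β (x, τ) *
              (Real.exp (2 * s * weight x₀ β (x, τ)) * |v (x, τ)| ^ 2) -
            transportWeight H x₀ β (x, -τ) *
              (Real.exp (2 * s * weight x₀ β (x, -τ)) * |v (x, -τ)| ^ 2)) ≤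
      M * ∫ x in Ω, (Real.exp (2 * s * weight x₀ β (x, τ)) * |v (x, τ)| ^ 2
          + Real.exp (2 * s * weight x₀ β (x, -τ)) * |v (x, -τ)| ^ 2) := by
    rw [← integral_const_mul]
    refine setIntegral_mono_on
      (hon _ (((ha τ hmem).mul (hw τ)).sub ((ha (-τ) hmem').mul (hw (-τ)))))
      (hon _ (continuousOn_const.mul ((hw τ).add (hw (-τ))))) hΩ.1.measurableSet fun x hx => ?_
    have h1 := (abs_le.1 (hM x hx τ hmem)).2
    have h2 := (abs_le.1 (hM x hx (-τ) hmem')).1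
    have h3 : 0 ≤ Real.exp (2 * s * weight x₀ β (x, τ)) * |v (x, τ)| ^ 2 := by positivity
    have h4 : 0 ≤ Real.exp (2 * s * weight x₀ β (x, -τ)) * |v (x, -τ)| ^ 2 := by positivity
    nlinarith [mul_le_mul_of_nonneg_right h1 h3, mul_le_mul_of_nonneg_right h2 h4]
  have h5 := mul_le_mul_of_nonneg_left
    (h.trans (add_le_add_right (mul_le_mul_of_nonneg_left hend hs.le) _)) (inv_pos.2 hκ0).le
  have h6 : κ⁻¹ * κ = 1 := inv_mul_cancel₀ hκ0.ne'
  rw [← mul_assoc, ← mul_assoc, h6, one_mul] at h5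
  refine h5.trans (le_of_eq ?_)
  ring

/-- The Carleman inequality for functions in `H¹`, in terms of their traces. -/
theorem carleman_of_isTrace (hd : 1 ≤ d) (hΩ : IsSmoothBoundedDomain Ω) (hτ : 0 < τ)
    (hH : ContDiffOn ℝ 1 H (Icc (-τ) τ)) (x₀ : Space d) {β κ s M : ℝ} (hs : 0 < s) (hκ0 : 0 < κ)
    (hκ : ∀ x ∈ Ω, ∀ t ∈ Ioo (-τ) τ,
      κ ≤ 2 * ⟪derivWithin H (Icc (-τ) τ) t, x - x₀⟫ - 2 * β)
    (hM : ∀ x ∈ Ω, ∀ t ∈ Icc (-τ) τ, |transportWeight H x₀ β (x, t)| ≤ M)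
    {u ut : Space d × ℝ → ℝ} {gu : Space d × ℝ → Space d} {g : Space d × ℝ → ℝ}
    (hu : IsH1With Ω τ u ut gu) (hg : IsTrace Ω τ u ut gu g) :
    s * ∫ p, Real.exp (2 * s * weight x₀ β p) * |u p| ^ 2 ∂(cylinderMeasure Ω τ) ≤
      κ⁻¹ * ∫ p, Real.exp (2 * s * weight x₀ β p) *
          |transport H ut gu p| ^ 2 ∂(cylinderMeasure Ω τ)
      + κ⁻¹ * s * ∫ p, Real.exp (2 * s * weight x₀ β p) * transportWeight H x₀ β p *
          ⟪H p.2, outerNormal Ω p.1⟫ * |g p| ^ 2 ∂(lateralMeasure Ω τ)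
      + κ⁻¹ * M * s * ∫ x in Ω, (Real.exp (2 * s * weight x₀ β (x, τ)) * |g (x, τ)| ^ 2
          + Real.exp (2 * s * weight x₀ β (x, -τ)) * |g (x, -τ)| ^ 2) := by
  obtain ⟨v, hv, l1, l2, l3, l4, l5, l6⟩ := hg.exists_approx
  have hec : Continuous fun p => Real.exp (2 * s * weight x₀ β p) :=
    (continuous_const.mul (contDiff_weight x₀ β).continuous).rexp
  have hK := hΩ.2.2.1.isCompact_closure
  obtain ⟨M₁, hM₁⟩ := (hK.prod (isCompact_Icc (a := -τ) (b := τ))).exists_bound_of_continuousOn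
    hec.continuousOn
  have hcyl : ∀ᵐ p ∂(cylinderMeasure Ω τ), ‖Real.exp (2 * s * weight x₀ β p)‖ ≤ M₁ := by
    filter_upwards [ae_mem_cylinder hΩ] with p hp
    exact hM₁ p ⟨subset_closure hp.1, Ioo_subset_Icc_self hp.2⟩
  have hends : ∀ t ∈ Icc (-τ) τ,
      ∀ᵐ x ∂(volume.restrict Ω), ‖Real.exp (2 * s * weight x₀ β (x, t))‖ ≤ M₁ := by
    intro t ht
    filter_upwards [ae_restrict_mem hΩ.1.measurableSet] with x hx
    exact hM₁ (x, t) ⟨subset_closure hx, ht⟩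
  have hlc : ContinuousOn (fun p => Real.exp (2 * s * weight x₀ β p) * transportWeight H x₀ β p *
      ⟪H p.2, outerNormal Ω p.1⟫) (frontier Ω ×ˢ Icc (-τ) τ) :=
    (hec.continuousOn.mul (continuousOn_transportWeight hH.continuousOn x₀ β _)).mul
      ((hH.continuousOn.comp continuousOn_snd fun p hp => hp.2).inner
        ((continuousOn_outerNormal hΩ).comp continuousOn_fst fun p hp => hp.1))
  obtain ⟨M₂, hM₂⟩ := ((isCompact_frontier hΩ).prod
    (isCompact_Icc (a := -τ) (b := τ))).exists_bound_of_continuousOn hlc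
  have t1 := (tendsto_integral_mul_sq hec.aestronglyMeasurable hcyl hu.memLp
    (fun n => (hv n).continuous.aestronglyMeasurable) l1).2
  have t2 := (tendsto_integral_mul_sq hec.aestronglyMeasurable hcyl
    (memLp_transport hΩ hH.continuousOn hu.memLp_time hu.memLp_space)
    (fun n => ((continuous_timeDeriv (hv n)).aestronglyMeasurable.add
      ((aestronglyMeasurable_coefficient hΩ hH.continuousOn).inner
        (continuous_spaceGrad (hv n)).aestronglyMeasurable) :
      AEStronglyMeasurable (transport H (timeDeriv (v n)) (spaceGrad (v n))) _))
    (tendsto_eLpNorm_transport hΩ hH.continuousOn hu.memLp_time.1 hu.memLp_space.1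
      (fun n => (continuous_timeDeriv (hv n)).aestronglyMeasurable)
      (fun n => (continuous_spaceGrad (hv n)).aestronglyMeasurable) l2 l3)).2
  have t3 := (tendsto_integral_mul_sq (integrable_lateralMeasure hd hΩ hlc).1
    ((ae_mem_lateral hd hΩ).mono fun p hp => hM₂ p ⟨hp.1, Ioo_subset_Icc_self hp.2⟩)
    hg.memLp_lateral (fun n => (hv n).continuous.aestronglyMeasurable) l4).2
  have hslice : ∀ t : ℝ, Continuous fun x : Space d => (x, t) := fun t => by fun_prop
  have hmem : τ ∈ Icc (-τ) τ := ⟨by linarith, le_rfl⟩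
  have hmem' : -τ ∈ Icc (-τ) τ := ⟨le_rfl, by linarith⟩
  obtain ⟨i5, t5⟩ := tendsto_integral_mul_sq (v := fun n x => v n (x, τ))
    (hec.comp (hslice τ)).aestronglyMeasurable (hends τ hmem) hg.memLp_top
    (fun n => ((hv n).continuous.comp (hslice τ)).aestronglyMeasurable) l5
  obtain ⟨i6, t6⟩ := tendsto_integral_mul_sq (v := fun n x => v n (x, -τ))
    (hec.comp (hslice (-τ))).aestronglyMeasurable (hends (-τ) hmem') hg.memLp_bot
    (fun n => ((hv n).continuous.comp (hslice (-τ))).aestronglyMeasurable) l6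
  have hon : ∀ n t, IntegrableOn
      (fun x => Real.exp (2 * s * weight x₀ β (x, t)) * |v n (x, t)| ^ 2) Ω := fun n t =>
    (((hec.mul ((hv n).continuous.abs.pow 2)).comp (hslice t)).continuousOn.integrableOn_compact
      hK).mono_set subset_closure
  have t7 : Tendsto (fun n => ∫ x in Ω, (Real.exp (2 * s * weight x₀ β (x, τ)) * |v n (x, τ)| ^ 2
      + Real.exp (2 * s * weight x₀ β (x, -τ)) * |v n (x, -τ)| ^ 2)) atTop
      (𝓝 (∫ x in Ω, (Real.exp (2 * s * weight x₀ β (x, τ)) * |g (x, τ)| ^ 2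
      + Real.exp (2 * s * weight x₀ β (x, -τ)) * |g (x, -τ)| ^ 2))) := by
    have h := integral_add i5 i6
    dsimp only [Function.comp_apply] at h
    rw [h]
    exact (t5.add t6).congr fun n => (integral_add (hon n τ) (hon n (-τ))).symm
  -- κ and M do not depend on the approximating function, so the inequality passes to the limit term
  -- by term.
  exact le_of_tendsto_of_tendsto' (t1.const_mul s)
    (((t2.const_mul κ⁻¹).add (t3.const_mul (κ⁻¹ * s))).add (t7.const_mul (κ⁻¹ * M * s)))
    fun n => carleman_of_contDiff_of_bound hd hΩ hτ hH x₀ hs hκ0 hκ hM (hv n)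

end Trace

end TransportCarleman

/-! ### The main theorem. -/

open TransportCarleman in
theorem proposition2p3 (d : ℕ) (hd : 1 ≤ d) (Ω : Set (Space d)) (hΩ : IsSmoothBoundedDomain Ω)
    (τ : ℝ) (hτ : 0 < τ) (c₀ : ℝ) (hc₀ : 1 / √2 < c₀) (hc₀' : c₀ < 1)
    (H : ℝ → Space d) (hH : ContDiffOn ℝ 1 H (Icc (-τ) τ))
    (ρ : ℝ) (hρ : 0 < ρ) (hHρ : ∀ t ∈ Icc (-τ) τ, ρ ≤ ‖derivWithin H (Icc (-τ) τ) t‖)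
    (θ₀ : Space d) (hθ₀ : ‖θ₀‖ = 1)
    (hHθ : ∀ t ∈ Icc (-τ) τ,
      c₀ ≤ ⟪derivWithin H (Icc (-τ) τ) t, θ₀⟫ / ‖derivWithin H (Icc (-τ) τ) t‖) :
    (∃ x₀ : Space d, IsAdmissiblePoint Ω τ c₀ H x₀) ∧
    ∀ x₀ : Space d, IsAdmissiblePoint Ω τ c₀ H x₀ →
    ∀ β : ℝ, 0 < β → β < ρ * (2 * c₀ ^ 2 - 1) * Metric.infDist x₀ Ω →
    ∃ C : ℝ, 0 < C ∧ ∃ C' : ℝ, 0 < C' ∧ ∀ s : ℝ, 0 < s →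
    ∀ (u ut : Space d × ℝ → ℝ) (gu : Space d × ℝ → Space d) (g : Space d × ℝ → ℝ),
    IsH1With Ω τ u ut gu → IsTrace Ω τ u ut gu g →
      s * ∫ p, Real.exp (2 * s * weight x₀ β p) * |u p| ^ 2 ∂(cylinderMeasure Ω τ) ≤
        C * ∫ p, Real.exp (2 * s * weight x₀ β p) * |transport H ut gu p| ^ 2
            ∂(cylinderMeasure Ω τ)
        + C * s * ∫ p, Real.exp (2 * s * weight x₀ β p) * transportWeight H x₀ β p *
            ⟪H p.2, outerNormal Ω p.1⟫ * |g p| ^ 2 ∂(lateralMeasure Ω τ)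
        + C' * s * ∫ x in Ω, (Real.exp (2 * s * weight x₀ β (x, τ)) * |g (x, τ)| ^ 2
            + Real.exp (2 * s * weight x₀ β (x, -τ)) * |g (x, -τ)| ^ 2) := by
  have hc0 : 0 < c₀ := lt_trans (by positivity) hc₀
  have hc1 : 0 < 2 * c₀ ^ 2 - 1 := by
    have h := pow_lt_pow_left₀ hc₀ (by positivity) two_ne_zero
    rw [div_pow, Real.sq_sqrt zero_le_two] at h
    linarith
  refine ⟨exists_isAdmissiblePoint hΩ.2.2.1 hc0 hc₀' hρ hHρ hθ₀ hHθ, ?_⟩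
  intro x₀ hx₀ β _ hβ
  -- κ = 2(δ - β) is the lower bound for Aa without 2|H|²; the constants are C = κ⁻¹ and C' = κ⁻¹M,
  -- independent of s.
  set κ := 2 * (ρ * (2 * c₀ ^ 2 - 1) * Metric.infDist x₀ Ω - β) with hκdef
  have hκ0 : 0 < κ := by rw [hκdef]; linarith
  have hκ : ∀ x ∈ Ω, ∀ t ∈ Ioo (-τ) τ,
      κ ≤ 2 * ⟪derivWithin H (Icc (-τ) τ) t, x - x₀⟫ - 2 * β := by
    intro x hx t ht
    have htI := Ioo_subset_Icc_self ht
    have hH0 := hρ.trans_le (hHρ t htI)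
    have hx0 : 0 < ‖x - x₀‖ :=
      norm_pos_iff.2 (sub_ne_zero.2 fun h => hx₀.1 (h ▸ subset_closure hx))
    have h1 := (le_div_iff₀ (mul_pos hH0 hx0)).1 (hx₀.2 x (subset_closure hx) t htI)
    have h2 : Metric.infDist x₀ Ω ≤ ‖x - x₀‖ := by
      rw [← dist_eq_norm, dist_comm]
      exact Metric.infDist_le_dist_of_mem hx
    have h3 : ρ * Metric.infDist x₀ Ω ≤ ‖derivWithin H (Icc (-τ) τ) t‖ * ‖x - x₀‖ :=
      mul_le_mul (hHρ t htI) h2 Metric.infDist_nonneg hH0.le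
    have h4 := mul_le_mul_of_nonneg_left h3 hc1.le
    rw [hκdef]
    linarith
  obtain ⟨M, hM0, hM⟩ := exists_bound_transportWeight hΩ hH.continuousOn x₀ β
  exact ⟨κ⁻¹, inv_pos.2 hκ0, κ⁻¹ * M, mul_pos (inv_pos.2 hκ0) hM0, fun s hs u ut gu g hu hg =>
    carleman_of_isTrace hd hΩ hτ hH x₀ hs hκ0 hκ hM hu hg⟩
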